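/- Let $0<c_0<1$ and $\nu>c_0-1$, and let $c=\{s\in\mathbb{C}:\operatorname{Re}s=c_0\}$. Let $f$ be a complex-valued function on $(0,\infty)$ that belongs to the space $\mathcal{M}^{-1}_{1/2,\nu}(L_c)$; that is, there is a function $f^*$, Lebesgue integrable on the line $c$, such that $$f(x)=\frac{1}{2\pi i}\int_{c_0-i\infty}^{c_0+i\infty}f^*(s)\,x^{-s}\,ds\quad\text{for all }x>0,$$ and such that $s^{\nu}e^{\pi|s|/2}f^*(s)$ is also Lebesgue integrable on $c$. For $\mu\in\mathbb{C}$ and $x>0$ let $$K_\mu(x)=\int_0^\infty e^{-x\cosh u}\cosh(\mu u)\,du$$ be the modified Bessel function of the second kind. Then for every $\tau\in\mathbb{R}$ the integral $$g(\tau)=\int_0^\infty e^{-y/2}K_{i\tau}\left(\frac y2\right)f(y)\,dy$$ converges absolutely, and for every $x>0$ $$f(x)=\frac{e^{x/2}}{\pi^2x}\int_{-\infty}^{\infty}\tau\sinh(\pi\tau)\,K_{i\tau}\left(\frac x2\right)g(\tau)\,d\tau,$$ where the integral with respect to $\tau$ exists as an improper Riemann integral. -/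

import Mathlib

open MeasureTheory Set Filter Topology

noncomputable section

/-- The modified Bessel function of the second kind (Macdonald function) of complex order `ν` at a
real argument `x > 0`, by its standard integral
`K_ν(x) = ∫_0^∞ exp (-x cosh u) cosh (ν u) du`, which converges absolutely for `x > 0`. -/
def besselK (ν : ℂ) (x : ℝ) : ℂ :=
  ∫ u : ℝ in Ioi 0, (Real.exp (-x * Real.cosh u) : ℂ) * Complex.cosh (ν * u)

/-- The functions on the positive half-line in the space `M⁻¹_{c₁,c₂}(L_c)`, where `c` is the
vertical line `Re s = c₀`: `f` is the inverse Mellin transform of some `F` integrable on `c`,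
`f(x) = (2πi)⁻¹ ∫_c F(s) x^{-s} ds` for all `x > 0`, for which `s^{c₂} exp (π c₁ |s|) F(s)` is
integrable on `c` too. Only the values of `f` on `(0, ∞)` and those of `F` on `c` matter. (The
space is considered for `2 sign c₁ + sign c₂ ≥ 0`, which always holds when `c₁ > 0`.) -/
def MemInvMellin (c₁ c₂ c₀ : ℝ) (f : ℝ → ℂ) : Prop :=
  ∃ F : ℂ → ℂ,
    Complex.VerticalIntegrable F c₀ ∧
    Complex.VerticalIntegrable
      (fun s : ℂ => s ^ (c₂ : ℂ) * (Real.exp (Real.pi * c₁ * ‖s‖) : ℂ) * F s) c₀ ∧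
    ∀ x : ℝ, 0 < x → f x = mellinInv c₀ F x

/-- The kernel `e^{-y/2} K_{iτ}(y/2)`. -/
def klKernel (τ y : ℝ) : ℂ :=
  (Real.exp (-y / 2) : ℂ) * besselK (Complex.I * τ) (y / 2)

/-- The modified Kontorovich–Lebedev transform
`g(τ) = ∫_0^∞ e^{-y/2} K_{iτ}(y/2) f(y) dy`. -/
def klTransform (f : ℝ → ℂ) (τ : ℝ) : ℂ :=
  ∫ y : ℝ in Ioi 0, klKernel τ y * f y

/-- `F` is Riemann integrable on `[a, b]`, `a < b`, with integral `J`: Mathlib's box integral with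
the Riemann parameters on the one-dimensional box with endpoints `a` and `b`, i.e. `J` is the limit
of the Riemann sums of `F` as the mesh of the tagged partition tends to zero. -/
def HasRiemannIntegral (F : ℝ → ℂ) (a b : ℝ) (hab : a < b) (J : ℂ) : Prop :=
  BoxIntegral.HasIntegral
    (⟨fun _ => a, fun _ => b, fun _ => hab⟩ : BoxIntegral.Box (Fin 1))
    BoxIntegral.IntegrationParams.Riemann
    (fun v : Fin 1 → ℝ => F (v 0))
    (volume : Measure (Fin 1 → ℝ)).toBoxAdditive.toSMul J

/-- The improper Riemann integral of `F` over `(-∞, ∞)` exists and equals `J`: `F` is Riemann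
integrable on every `[a, b]`, and the integrals over `[a, b]` tend to `J` as `a → -∞` and `b → ∞`
independently of each other. -/
def HasImproperRiemannIntegral (F : ℝ → ℂ) (J : ℂ) : Prop :=
  ∃ R : ℝ → ℝ → ℂ,
    (∀ (a b : ℝ) (hab : a < b), HasRiemannIntegral F a b hab (R a b)) ∧
    Tendsto (fun p : ℝ × ℝ => R p.1 p.2) (atBot ×ˢ atTop) (𝓝 J)

end

/-! Since f is a superposition of powers y^{-s} along Re s = c₀, Fubini reduces the theorem to
inverting the transform on a single power with 0 < Re s < 1
(`integral_sinh_mul_besselK_mul_mellin`).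

The power case compares two Fourier integrals in u. The Mellin transform of the kernel is ½ Γ(1-s)
times the Fourier integral of cosh(u/2)^{2(s-1)} (`integral_klKernel_mul_cpow`), and 2iτ K_{iτ}(x)
is the Fourier integral of the odd function x sinh u e^{-x cosh u} (`expIntegral_sinhKernel`). As
cosh(z/2)^{2(s-1)} is holomorphic for |Im z| < π, a factor e^{aτ} amounts to moving the line of
integration to Im z = a, and Parseval turns the τ-integral into a u-integral
(`integral_mul_besselK_mul_exp`). When a → π, the values on the two sides differ by 2i sin(πs)
sinh(u/2)^{2(s-1)} (`coshPow_jump`). The substitution w = sinh²(u/2) then yields Γ(s), and the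
reflection formula cancels Γ(s) Γ(1-s) sin(πs) against π.

Fubini needs an exponential budget. Shifting lines bounds the Mellin transform by e^{(b-β)|t|}
e^{-b|τ|} for any b < π and β < π/2, with t = Im s. The choice b = 5π/6, β = 5π/12 beats the weight
τ sinh(πτ) K_{iτ}, of size e^{3π|τ|/4}, and costs e^{5π|t|/12}, which the hypothesis with e^{π|s|/2}
covers, leaving π/12 to absorb |s|^{-ν}. -/

noncomputable section

/-! ### Fourier integrals of functions holomorphic in a strip -/

/-- The Fourier integral `∫ h(u) e^{iτu} du`. -/
def expIntegral (h : ℝ → ℂ) (τ : ℝ) : ℂ := ∫ u : ℝ, h u * Complex.exp (Complex.I * τ * u)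

lemma norm_exp_I_mul_mul (τ u : ℝ) : ‖Complex.exp (Complex.I * τ * u)‖ = 1 := by
  rw [Complex.norm_exp]; simp

lemma integrable_exp_neg_mul_abs {ε : ℝ} (hε : 0 < ε) :
    Integrable (fun u : ℝ => Real.exp (-ε * |u|)) := by
  rw [← integrableOn_univ, ← Iic_union_Ioi (a := (0 : ℝ))]
  refine IntegrableOn.union ?_ ?_
  · refine (integrableOn_exp_mul_Iic hε 0).congr_fun (fun u hu => ?_) measurableSet_Iic
    have h : u ≤ 0 := hu
    simp [abs_of_nonpos h]
  · refine (integrableOn_exp_mul_Ioi (neg_lt_zero.2 hε) 0).congr_fun (fun u hu => ?_)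
      measurableSet_Ioi
    have h : 0 < u := hu
    simp [abs_of_pos h]

lemma integral_eq_integral_Ioi_add_neg {φ : ℝ → ℂ} (hφ : Integrable φ) :
    ∫ u, φ u = ∫ u in Ioi 0, (φ u + φ (-u)) := by
  rw [← intervalIntegral.integral_Iic_add_Ioi (b := (0 : ℝ)) hφ.integrableOn hφ.integrableOn,
    integral_add hφ.integrableOn hφ.comp_neg.integrableOn, add_comm]
  congr 1
  have := integral_comp_neg_Ioi (0 : ℝ) φ
  rw [this, neg_zero]

lemma integrable_of_norm_le_exp_neg_abs {φ : ℝ → ℂ} {C ε : ℝ} (hε : 0 < ε)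
    (hφ : Continuous φ) (hb : ∀ u, ‖φ u‖ ≤ C * Real.exp (-ε * |u|)) : Integrable φ :=
  ((integrable_exp_neg_mul_abs hε).const_mul C).mono' hφ.aestronglyMeasurable (ae_of_all _ hb)

/-- Horizontal lines in a strip where the function is holomorphic and decays exponentially can be
moved. -/
theorem integral_add_mul_I_eq {h : ℂ → ℂ} {b C ε : ℝ} (hε : 0 < ε)
    (hd : ∀ z : ℂ, |z.im| ≤ |b| → DifferentiableAt ℂ h z)
    (hb : ∀ u v : ℝ, |v| ≤ |b| → ‖h (u + v * Complex.I)‖ ≤ C * Real.exp (-ε * |u|)) :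
    ∫ u : ℝ, h (u + b * Complex.I) = ∫ u : ℝ, h u := by
  have hcont : ∀ v : ℝ, |v| ≤ |b| → Continuous fun u : ℝ => h (u + v * Complex.I) := by
    intro v hv
    rw [continuous_iff_continuousAt]
    intro u
    have h1 : ContinuousAt h (u + v * Complex.I) := (hd _ (by simpa using hv)).continuousAt
    exact ContinuousAt.comp (f := fun u : ℝ => (u + v * Complex.I : ℂ)) h1 (by fun_prop)
  have hint : ∀ v : ℝ, |v| ≤ |b| → Integrable fun u : ℝ => h (u + v * Complex.I) := fun v hv =>
    integrable_of_norm_le_exp_neg_abs hε (hcont v hv) (fun u => hb u v hv)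
  have hrect : ∀ R : ℝ, (((∫ x : ℝ in -R..R, h (x + (0 : ℝ) * Complex.I)) -
      ∫ x : ℝ in -R..R, h (x + b * Complex.I)) +
      Complex.I • ∫ y : ℝ in (0 : ℝ)..b, h (R + y * Complex.I)) -
      Complex.I • ∫ y : ℝ in (0 : ℝ)..b, h ((-R : ℝ) + y * Complex.I) = 0 := by
    intro R
    have := Complex.integral_boundary_rect_eq_zero_of_differentiableOn h
      (⟨-R, 0⟩ : ℂ) (⟨R, b⟩ : ℂ) (by
        intro z hz
        refine (hd z ?_).differentiableWithinAt
        have h2 : z.im ∈ uIcc 0 b := hz.2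
        have := abs_sub_left_of_mem_uIcc h2
        simpa using this)
    simpa using this
  have hexp : Tendsto (fun R : ℝ => C * Real.exp (-ε * |R|) * |b|) atTop (𝓝 0) := by
    have h1 : Tendsto (fun R : ℝ => ε * |R|) atTop atTop :=
      Tendsto.const_mul_atTop hε tendsto_abs_atTop_atTop
    have h2 := Real.tendsto_exp_neg_atTop_nhds_zero.comp h1
    have h3 := (h2.const_mul C).mul_const |b|
    simpa [Function.comp_def] using h3
  -- The sign σ treats the two vertical sides of the rectangle at once.
  have hside : ∀ σ : ℝ, |σ| = 1 → Tendsto (fun R : ℝ =>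
      Complex.I • ∫ y : ℝ in (0 : ℝ)..b, h ((σ * R : ℝ) + y * Complex.I)) atTop (𝓝 0) := by
    intro σ hσ
    refine squeeze_zero_norm (fun R => ?_) hexp
    rw [norm_smul, Complex.norm_I, one_mul]
    have := intervalIntegral.norm_integral_le_of_norm_le_const (a := (0 : ℝ)) (b := b)
      (f := fun y : ℝ => h ((σ * R : ℝ) + y * Complex.I)) (C := C * Real.exp (-ε * |R|)) (by
        intro y hy
        have h1 := hb (σ * R) y (by
          have := abs_sub_left_of_mem_uIcc (uIoc_subset_uIcc hy)
          simpa using this)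
        simpa [abs_mul, hσ] using h1)
    simpa using this
  have hmain : ∀ v : ℝ, |v| ≤ |b| →
      Tendsto (fun R : ℝ => ∫ x : ℝ in -R..R, h (x + v * Complex.I)) atTop
        (𝓝 (∫ x : ℝ, h (x + v * Complex.I))) := fun v hv =>
    intervalIntegral_tendsto_integral (hint v hv) tendsto_neg_atTop_atBot tendsto_id
  have hlim := (((hmain 0 (by simp)).sub (hmain b le_rfl)).add (hside 1 (by simp))).sub
    (hside (-1) (by simp))
  have h0 : (∫ x : ℝ, h (x + (0 : ℝ) * Complex.I)) - (∫ x : ℝ, h (x + b * Complex.I)) = 0 := by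
    have h1 := tendsto_nhds_unique hlim (tendsto_const_nhds.congr fun R => by
      have := hrect R
      simp only [one_mul, neg_mul]
      exact this.symm)
    simpa using h1
  have := sub_eq_zero.1 h0
  simpa using this.symm

/-- The Fourier integral along a shifted line. -/
theorem expIntegral_add_mul_I {h : ℂ → ℂ} {b C ε : ℝ} (hε : 0 < ε)
    (hd : ∀ z : ℂ, |z.im| ≤ |b| → DifferentiableAt ℂ h z)
    (hb : ∀ u v : ℝ, |v| ≤ |b| → ‖h (u + v * Complex.I)‖ ≤ C * Real.exp (-ε * |u|)) (τ : ℝ) :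
    expIntegral (fun u => h (u + b * Complex.I)) τ =
      Real.exp (b * τ) * expIntegral (fun u => h u) τ := by
  have := integral_add_mul_I_eq (h := fun z => h z * Complex.exp (Complex.I * τ * z))
    (b := b) (C := C * Real.exp (|b| * |τ|)) hε
    (fun z hz => (hd z hz).mul (by fun_prop)) (by
      intro u v hv
      rw [norm_mul, Complex.norm_exp]
      have h1 : (Complex.I * τ * (u + v * Complex.I)).re = -(τ * v) := by simp
      rw [h1]
      have h2 : -(τ * v) ≤ |b| * |τ| := by
        have := neg_abs_le (τ * v)
        rw [abs_mul] at this
        nlinarith [abs_nonneg τ]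
      calc _ ≤ (C * Real.exp (-ε * |u|)) * Real.exp (|b| * |τ|) :=
            mul_le_mul (hb u v hv) (Real.exp_le_exp.2 h2) (Real.exp_pos _).le
              ((norm_nonneg _).trans (hb u v hv))
        _ = _ := by ring)
  unfold expIntegral
  rw [← this, ← integral_const_mul]
  refine integral_congr_ae (ae_of_all _ fun u => ?_)
  have h3 : Complex.exp (Complex.I * τ * (u + b * Complex.I)) =
      Complex.exp (Complex.I * τ * u) * Complex.exp (-((b * τ : ℝ) : ℂ)) := by
    rw [← Complex.exp_add]; congr 1; push_cast
    linear_combination (τ * b : ℂ) * Complex.I_mul_I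
  simp only [h3]
  have h4 : Complex.exp ((b * τ : ℝ) : ℂ) * Complex.exp (-((b * τ : ℝ) : ℂ)) = 1 := by
    rw [← Complex.exp_add]; simp
  rw [Complex.ofReal_exp]
  linear_combination (-(h (u + b * Complex.I) * Complex.exp (Complex.I * τ * u))) * h4

lemma norm_expIntegral_le (φ : ℝ → ℂ) (τ : ℝ) : ‖expIntegral φ τ‖ ≤ ∫ u, ‖φ u‖ := by
  refine (norm_integral_le_integral_norm _).trans_eq ?_
  simp [norm_exp_I_mul_mul]

/-- Exponential decay of the Fourier integral of a function holomorphic in a strip. -/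
theorem norm_expIntegral_le_exp {h : ℂ → ℂ} {b C ε : ℝ} (hε : 0 < ε) (hb0 : 0 ≤ b)
    (hd : ∀ z : ℂ, |z.im| ≤ b → DifferentiableAt ℂ h z)
    (hb : ∀ u v : ℝ, |v| ≤ b → ‖h (u + v * Complex.I)‖ ≤ C * Real.exp (-ε * |u|)) (τ : ℝ) :
    ‖expIntegral (fun u => h u) τ‖ ≤
      (C * ∫ u : ℝ, Real.exp (-ε * |u|)) * Real.exp (-b * |τ|) := by
  -- The line is moved to the side matching the sign of τ, so that the shift factor is e^{b|τ|}.
  obtain ⟨σ, hσ, hστ⟩ : ∃ σ : ℝ, |σ| = 1 ∧ σ * τ = |τ| := by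
    rcases le_total 0 τ with h0 | h0
    · exact ⟨1, by simp, by simp [abs_of_nonneg h0]⟩
    · exact ⟨-1, by simp, by simp [abs_of_nonpos h0]⟩
  have hσb : |σ * b| = b := by rw [abs_mul, hσ, one_mul, abs_of_nonneg hb0]
  have h1 := expIntegral_add_mul_I (h := h) (b := σ * b) hε (by rwa [hσb]) (by rwa [hσb]) τ
  have h2 : ‖expIntegral (fun u => h (u + (σ * b : ℝ) * Complex.I)) τ‖ ≤
      C * ∫ u : ℝ, Real.exp (-ε * |u|) := by
    rw [← integral_const_mul]
    refine (norm_expIntegral_le _ τ).trans (integral_mono_of_nonneg (ae_of_all _ fun u => norm_nonneg _)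
      ((integrable_exp_neg_mul_abs hε).const_mul C) (ae_of_all _ fun u => ?_))
    exact hb u (σ * b) hσb.le
  rw [h1, norm_mul, Complex.norm_real, Real.norm_of_nonneg (Real.exp_pos _).le] at h2
  have h3 : σ * b * τ = b * |τ| := by rw [← hστ]; ring
  rw [h3] at h2
  rw [neg_mul, Real.exp_neg, ← div_eq_mul_inv, le_div_iff₀ (Real.exp_pos _), mul_comm]
  exact h2

lemma expIntegral_eq_fourier (φ : ℝ → ℂ) (τ : ℝ) :
    expIntegral φ τ = FourierTransform.fourier φ (-τ / (2 * Real.pi)) := by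
  rw [Real.fourier_real_eq_integral_exp_smul]
  unfold expIntegral
  refine integral_congr_ae (ae_of_all _ fun u => ?_)
  simp only [smul_eq_mul]
  rw [mul_comm]
  congr 2
  have : -2 * Real.pi * u * (-τ / (2 * Real.pi)) = τ * u := by
    field_simp
  rw [this]; push_cast; ring

/-- Parseval's formula for Fourier integrals. -/
theorem integral_expIntegral_mul_expIntegral {k ψ : ℝ → ℂ} (hk : Integrable k)
    (hψ : Integrable ψ) (hψc : Continuous ψ) (hψi : Integrable (expIntegral ψ)) :
    ∫ τ, expIntegral k τ * expIntegral ψ τ = 2 * Real.pi * ∫ u, k u * ψ (-u) := by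
  have hpi : (2 * Real.pi) ≠ 0 := by positivity
  have hF : FourierTransform.fourier ψ = fun w => expIntegral ψ (-(2 * Real.pi) * w) := by
    funext w
    rw [expIntegral_eq_fourier]; field_simp
  have hFi : Integrable (FourierTransform.fourier ψ) := by
    rw [hF]
    exact hψi.comp_mul_left' (neg_ne_zero.2 hpi)
  have hinv := hψc.fourierInv_fourier_eq hψ hFi
  have h1 : ∫ w, FourierTransform.fourier k w * FourierTransform.fourier ψ w =
      ∫ u, k u * FourierTransform.fourier (FourierTransform.fourier ψ) u := by
    simpa using! (VectorFourier.integral_fourierIntegral_smul_eq_flip (L := innerₗ ℝ)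
      Real.continuous_fourierChar continuous_inner hk hFi)
  have h2 : ∀ u, FourierTransform.fourier (FourierTransform.fourier ψ) u = ψ (-u) := by
    intro u
    rw [← congrFun hinv (-u), Real.fourierInv_eq_fourier_neg, neg_neg]
  simp only [h2] at h1
  rw [← h1]
  have h3 := Measure.integral_comp_mul_left (fun w => FourierTransform.fourier k w *
    FourierTransform.fourier ψ w) (-(2 * Real.pi)⁻¹)
  have h4 : |(-(2 * Real.pi)⁻¹)⁻¹| = 2 * Real.pi := by
    rw [inv_neg, inv_inv, abs_neg, abs_of_pos (by positivity)]
  rw [h4] at h3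
  have h5 : ∀ τ : ℝ, -τ / (2 * Real.pi) = -(2 * Real.pi)⁻¹ * τ := fun τ => by field_simp
  simp only [expIntegral_eq_fourier, h5]
  rw [h3, Complex.real_smul]
  push_cast; ring

lemma expIntegral_of_even {φ : ℝ → ℂ} (hφ : Integrable φ) (he : ∀ u, φ (-u) = φ u) (τ : ℝ) :
    expIntegral φ τ = 2 * ∫ u in Ioi 0, φ u * Complex.cosh (Complex.I * τ * u) := by
  unfold expIntegral
  rw [integral_eq_integral_Ioi_add_neg, ← integral_const_mul]
  · refine integral_congr_ae (ae_of_all _ fun u => ?_)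
    simp only [he, Complex.cosh, Complex.ofReal_neg, mul_neg]
    ring
  · have := hφ.bdd_mul (c := 1) (f := fun u : ℝ => Complex.exp (Complex.I * τ * u))
      (by fun_prop) (ae_of_all _ fun u => (norm_exp_I_mul_mul τ u).le)
    simpa only [mul_comm] using this

/-! ### The Macdonald function of imaginary order as a Fourier integral -/

lemma exp_abs_le_two_mul_cosh (u : ℝ) : Real.exp |u| ≤ 2 * Real.cosh u := by
  rw [← Real.cosh_abs, Real.cosh_eq]
  linarith [Real.exp_pos (-|u|)]

/-- From e^{-y} ≤ 1/y with y = x cosh u. The doubly exponential decay is deliberately weakened to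
the form that the strip lemmas accept. -/
lemma exp_neg_mul_cosh_le {x : ℝ} (hx : 0 < x) (u : ℝ) :
    Real.exp (-(x * Real.cosh u)) ≤ 2 / x * Real.exp (-1 * |u|) := by
  have hc := Real.cosh_pos u
  have hy : 0 < x * Real.cosh u := mul_pos hx hc
  have h1 := Real.add_one_le_exp (x * Real.cosh u)
  have h2 := exp_abs_le_two_mul_cosh u
  rw [Real.exp_neg, neg_one_mul, Real.exp_neg, div_mul_eq_mul_div, ← div_eq_mul_inv, div_div,
    inv_eq_one_div, div_le_div_iff₀ (Real.exp_pos _) (by positivity)]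
  nlinarith [Real.exp_pos |u|]

lemma cosh_mul_exp_neg_mul_cosh_le {x : ℝ} (hx : 0 < x) (u : ℝ) :
    x * Real.cosh u * Real.exp (-(x * Real.cosh u)) ≤ 4 / x * Real.exp (-1 * |u|) := by
  have hc := Real.cosh_pos u
  have hy : 0 < x * Real.cosh u := mul_pos hx hc
  have h1 := Real.quadratic_le_exp_of_nonneg hy.le
  have h2 := exp_abs_le_two_mul_cosh u
  have h3 : x * Real.cosh u * Real.exp (-(x * Real.cosh u)) ≤ 2 / (x * Real.cosh u) := by
    rw [Real.exp_neg, ← div_eq_mul_inv, div_le_div_iff₀ (Real.exp_pos _) hy]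
    nlinarith
  refine h3.trans ?_
  rw [neg_one_mul, Real.exp_neg, div_mul_eq_mul_div, ← div_eq_mul_inv, div_div,
    div_le_div_iff₀ (by positivity) (by positivity)]
  nlinarith

lemma norm_exp_neg_mul_cosh (x u v : ℝ) :
    ‖Complex.exp (-x * Complex.cosh (u + v * Complex.I))‖ =
      Real.exp (-(x * Real.cosh u * Real.cos v)) := by
  rw [Complex.norm_exp, Complex.cosh_add, Complex.cosh_mul_I, Complex.sinh_mul_I]
  congr 1
  rw [← Complex.ofReal_cosh, ← Complex.ofReal_sinh, ← Complex.ofReal_cos, ← Complex.ofReal_sin]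
  simp only [Complex.mul_re, Complex.add_re, Complex.neg_re, Complex.neg_im, Complex.ofReal_re,
    Complex.ofReal_im, Complex.I_re, Complex.I_im, Complex.mul_im]
  ring

/-- Off the real axis the parameter x is effectively replaced by x cos v ≥ x cos b. Positivity of
cos b limits this argument to decay rates below π/2 for K_{iτ}. -/
lemma norm_exp_neg_mul_cosh_le {x b u v : ℝ} (hx : 0 < x) (hb : b < Real.pi / 2)
    (hv : |v| ≤ b) : ‖Complex.exp (-x * Complex.cosh (u + v * Complex.I))‖ ≤
      2 / (x * Real.cos b) * Real.exp (-1 * |u|) := by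
  have hb0 : 0 ≤ b := (abs_nonneg v).trans hv
  have hcb : 0 < Real.cos b := Real.cos_pos_of_mem_Ioo ⟨by linarith [Real.pi_pos], hb⟩
  have hcv : Real.cos b ≤ Real.cos v := by
    rw [← Real.cos_abs v]
    exact Real.cos_le_cos_of_nonneg_of_le_pi (abs_nonneg v) (by linarith [Real.pi_pos]) hv
  rw [norm_exp_neg_mul_cosh]
  refine le_trans (Real.exp_le_exp.2 ?_) (exp_neg_mul_cosh_le (mul_pos hx hcb) u)
  have := Real.cosh_pos u
  have h1 : x * Real.cosh u * Real.cos b ≤ x * Real.cosh u * Real.cos v :=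
    mul_le_mul_of_nonneg_left hcv (by positivity)
  linarith

lemma integrable_exp_neg_mul_cosh {x : ℝ} (hx : 0 < x) :
    Integrable fun u : ℝ => Complex.exp (-x * Complex.cosh u) := by
  refine integrable_of_norm_le_exp_neg_abs one_pos (by fun_prop) (C := 2 / (x * Real.cos 0))
    fun u => ?_
  have := norm_exp_neg_mul_cosh_le (u := u) hx (by positivity : (0 : ℝ) < Real.pi / 2)
    (abs_zero (α := ℝ)).le
  simpa using this

theorem besselK_I_mul {x : ℝ} (hx : 0 < x) (τ : ℝ) :
    besselK (Complex.I * τ) x =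
      1 / 2 * expIntegral (fun u => Complex.exp (-x * Complex.cosh u)) τ := by
  rw [expIntegral_of_even (integrable_exp_neg_mul_cosh hx) (by simp)]
  unfold besselK
  push_cast
  ring

theorem norm_besselK_I_mul_le {x b : ℝ} (hx : 0 < x) (hb0 : 0 ≤ b) (hb : b < Real.pi / 2) :
    ∃ C : ℝ, ∀ τ : ℝ, ‖besselK (Complex.I * τ) x‖ ≤ C * Real.exp (-b * |τ|) := by
  refine ⟨1 / 2 * (2 / (x * Real.cos b) * ∫ u : ℝ, Real.exp (-1 * |u|)), fun τ => ?_⟩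
  have := norm_expIntegral_le_exp (h := fun z => Complex.exp (-x * Complex.cosh z)) one_pos hb0
    (fun z _ => by fun_prop) (fun u v hv => norm_exp_neg_mul_cosh_le hx hb hv) τ
  rw [besselK_I_mul hx, norm_mul, mul_assoc (1 / 2 : ℝ)]
  have h2 : ‖(1 / 2 : ℂ)‖ = 1 / 2 := by simp
  rw [h2]
  exact mul_le_mul_of_nonneg_left this (by norm_num)

/-- The odd function `x sinh u e^{-x cosh u}`. -/
def sinhKernel (x u : ℝ) : ℂ := (x * Real.sinh u * Real.exp (-(x * Real.cosh u)) : ℝ)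

lemma continuous_sinhKernel (x : ℝ) : Continuous (sinhKernel x) := by
  unfold sinhKernel
  fun_prop

lemma sinhKernel_neg (x u : ℝ) : sinhKernel x (-u) = -sinhKernel x u := by
  simp [sinhKernel]

lemma norm_sinhKernel_le {x : ℝ} (hx : 0 < x) (u : ℝ) :
    ‖sinhKernel x u‖ ≤ 4 / x * Real.exp (-1 * |u|) := by
  refine le_trans ?_ (cosh_mul_exp_neg_mul_cosh_le hx u)
  rw [sinhKernel, Complex.norm_real, norm_mul, norm_mul, Real.norm_of_nonneg hx.le,
    Real.norm_of_nonneg (Real.exp_pos _).le, Real.norm_eq_abs]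
  have : |Real.sinh u| ≤ Real.cosh u := by
    rw [Real.abs_sinh, ← Real.cosh_abs]
    exact (Real.sinh_lt_cosh _).le
  gcongr

lemma integrable_sinhKernel {x : ℝ} (hx : 0 < x) : Integrable (sinhKernel x) :=
  integrable_of_norm_le_exp_neg_abs one_pos (continuous_sinhKernel x) (norm_sinhKernel_le hx)

/-- Integration by parts: `sinhKernel x` is the derivative of -e^{-x cosh u}. This accounts for the
factor τ in the inversion measure. -/
theorem expIntegral_sinhKernel {x : ℝ} (hx : 0 < x) (τ : ℝ) :
    expIntegral (sinhKernel x) τ = 2 * Complex.I * τ * besselK (Complex.I * τ) x := by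
  have hE := integrable_exp_neg_mul_cosh hx
  have hexp : AEStronglyMeasurable (fun u : ℝ => Complex.exp (Complex.I * τ * u)) := by fun_prop
  have hb : ∀ᵐ u : ℝ, ‖Complex.exp (Complex.I * τ * u)‖ ≤ 1 :=
    ae_of_all _ fun u => (norm_exp_I_mul_mul τ u).le
  have hU : ∀ u : ℝ, HasDerivAt (fun u : ℝ => Complex.exp (Complex.I * τ * u))
      (Complex.exp (Complex.I * τ * u) * (Complex.I * τ)) u := by
    intro u
    have h1 : HasDerivAt (fun u : ℝ => Complex.I * τ * (u : ℂ)) (Complex.I * τ) u := by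
      simpa using (Complex.ofRealCLM.hasDerivAt (x := u)).const_mul (Complex.I * τ)
    exact h1.cexp
  have hV : ∀ u : ℝ, HasDerivAt (fun u : ℝ => -Complex.exp (-x * Complex.cosh u))
      (sinhKernel x u) u := by
    intro u
    have h1 : HasDerivAt (fun u : ℝ => -Real.exp (-x * Real.cosh u))
        (x * Real.sinh u * Real.exp (-(x * Real.cosh u))) u := by
      have h2 := (((Real.hasDerivAt_cosh u).const_mul (-x)).exp).neg
      have h3 : -(Real.exp (-x * Real.cosh u) * (-x * Real.sinh u)) =
          x * Real.sinh u * Real.exp (-(x * Real.cosh u)) := by rw [neg_mul x]; ring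
      rwa [h3] at h2
    have h2 := h1.ofReal_comp
    simpa [sinhKernel] using h2
  have := integral_mul_deriv_eq_deriv_mul_of_integrable
    (u := fun u : ℝ => Complex.exp (Complex.I * τ * u))
    (v := fun u : ℝ => -Complex.exp (-x * Complex.cosh u))
    (fun u _ => hU u) (fun u _ => hV u) ((integrable_sinhKernel hx).bdd_mul hexp hb)
    (by
      refine ((hE.bdd_mul hexp hb).const_mul (-(Complex.I * τ))).congr (ae_of_all _ fun u => ?_)
      simp only [Pi.mul_apply]; ring)
    (by
      refine ((hE.bdd_mul hexp hb).neg).congr (ae_of_all _ fun u => ?_)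
      simp)
  rw [besselK_I_mul hx]
  unfold expIntegral
  simp only [mul_comm (sinhKernel x _)]
  rw [this, ← integral_neg, ← integral_const_mul, ← integral_const_mul]
  refine integral_congr_ae (ae_of_all _ fun u => ?_)
  simp only []
  ring

/-! ### Powers of cosh(z/2) in the strip |Im z| < π -/

lemma cosh_add_mul_I_eq (p q : ℝ) : Complex.cosh (p + q * Complex.I) =
    (Real.cosh p * Real.cos q : ℝ) + (Real.sinh p * Real.sin q : ℝ) * Complex.I := by
  rw [Complex.cosh_add, Complex.cosh_mul_I, Complex.sinh_mul_I]
  push_cast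
  ring

lemma re_cosh_add_mul_I (p q : ℝ) :
    (Complex.cosh (p + q * Complex.I)).re = Real.cosh p * Real.cos q := by
  rw [cosh_add_mul_I_eq, Complex.add_re, Complex.re_ofReal_mul, Complex.ofReal_re, Complex.I_re]
  ring

lemma norm_cosh_add_mul_I_sq (p q : ℝ) :
    ‖Complex.cosh (p + q * Complex.I)‖ ^ 2 = Real.sinh p ^ 2 + Real.cos q ^ 2 := by
  rw [cosh_add_mul_I_eq, ← Complex.normSq_eq_norm_sq, Complex.normSq_add_mul_I]
  nlinarith [Real.cosh_sq p, Real.sin_sq_add_cos_sq q]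

lemma cosh_mul_cos_le_norm_cosh (p q : ℝ) :
    Real.cosh p * Real.cos q ≤ ‖Complex.cosh (p + q * Complex.I)‖ := by
  rw [← re_cosh_add_mul_I]
  exact Complex.re_le_norm _

lemma abs_sinh_le_norm_cosh (p q : ℝ) :
    |Real.sinh p| ≤ ‖Complex.cosh (p + q * Complex.I)‖ := by
  refine abs_le_of_sq_le_sq ?_ (norm_nonneg _)
  rw [norm_cosh_add_mul_I_sq]
  nlinarith [sq_nonneg (Real.cos q)]

lemma cos_pos_of_abs_lt {q : ℝ} (hq : |q| < Real.pi / 2) : 0 < Real.cos q :=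
  Real.cos_pos_of_mem_Ioo (abs_lt.1 hq)

lemma re_cosh_add_mul_I_pos {p q : ℝ} (hq : |q| < Real.pi / 2) :
    0 < (Complex.cosh (p + q * Complex.I)).re := by
  rw [re_cosh_add_mul_I]
  exact mul_pos (Real.cosh_pos p) (cos_pos_of_abs_lt hq)

/-- The cosine of the argument is cosh p cos q / |cosh(p + iq)|, and |cosh(p + iq)|² = cosh² p -
sin² q ≤ cosh² p, so it is at least cos q. -/
lemma abs_arg_cosh_le {p q : ℝ} (hq : |q| < Real.pi / 2) :
    |(Complex.cosh (p + q * Complex.I)).arg| ≤ |q| := by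
  have hre := re_cosh_add_mul_I_pos (p := p) hq
  set w := Complex.cosh (p + q * Complex.I) with hw
  have hw0 : w ≠ 0 := fun h => by rw [h] at hre; simp at hre
  have hn : 0 < ‖w‖ := norm_pos_iff.2 hw0
  have hcos : Real.cos |q| ≤ Real.cos |w.arg| := by
    rw [Real.cos_abs, Real.cos_abs, Complex.cos_arg hw0, le_div_iff₀ hn, hw, re_cosh_add_mul_I,
      mul_comm]
    refine mul_le_mul_of_nonneg_right ?_ (cos_pos_of_abs_lt hq).le
    refine abs_le_of_sq_le_sq' ?_ (Real.cosh_pos p).le |>.2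
    rw [norm_cosh_add_mul_I_sq]
    nlinarith [Real.cosh_sq p, Real.sin_sq_add_cos_sq q, sq_nonneg (Real.sin q)]
  by_contra hlt
  push Not at hlt
  have := Real.cos_lt_cos_of_nonneg_of_le_pi (abs_nonneg q) (Complex.abs_arg_le_pi w) hlt
  linarith

/-- The function `cosh (z/2) ^ (2(s - 1))`, holomorphic in the strip `|Im z| < π`. -/
def coshPow (s z : ℂ) : ℂ := Complex.cosh (z / 2) ^ (2 * (s - 1))

lemma div_two_eq (z : ℂ) : z / 2 = ((z.re / 2 : ℝ) : ℂ) + ((z.im / 2 : ℝ) : ℂ) * Complex.I := by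
  conv_lhs => rw [← Complex.re_add_im z]
  push_cast; ring

lemma abs_half_lt {v : ℝ} (hv : |v| < Real.pi) : |v / 2| < Real.pi / 2 := by
  rw [abs_div, abs_two]; linarith

lemma cosh_half_re_pos {z : ℂ} (hz : |z.im| < Real.pi) : 0 < (Complex.cosh (z / 2)).re := by
  rw [div_two_eq]
  exact re_cosh_add_mul_I_pos (abs_half_lt hz)

lemma differentiableAt_coshPow (s : ℂ) {z : ℂ} (hz : |z.im| < Real.pi) :
    DifferentiableAt ℂ (coshPow s) z := by
  unfold coshPow
  refine DifferentiableAt.cpow (by fun_prop) (by fun_prop) ?_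
  exact Or.inl (cosh_half_re_pos hz)

lemma coshPow_neg (s z : ℂ) : coshPow s (-z) = coshPow s z := by
  simp [coshPow, neg_div]

/-- The exponential comes from e^{-arg(w) Im α} with Im α = 2 Im s and |arg w| ≤ |Im z|/2. -/
lemma norm_coshPow_le (s : ℂ) {z : ℂ} (hz : |z.im| < Real.pi) :
    ‖coshPow s z‖ ≤ ‖Complex.cosh (z / 2)‖ ^ (2 * (s.re - 1)) * Real.exp (|z.im| * |s.im|) := by
  have hne : Complex.cosh (z / 2) ≠ 0 := fun h => by
    have := cosh_half_re_pos hz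
    rw [h] at this; simp at this
  have hre : (2 * (s - 1)).re = 2 * (s.re - 1) := by simp
  have him : (2 * (s - 1)).im = 2 * s.im := by simp
  rw [coshPow, Complex.norm_cpow_of_ne_zero hne, hre, him, div_eq_mul_inv, ← Real.exp_neg]
  refine mul_le_mul_of_nonneg_left (Real.exp_le_exp.2 ?_) (by positivity)
  have h1 : |(Complex.cosh (z / 2)).arg| ≤ |z.im| / 2 := by
    rw [div_two_eq]
    refine (abs_arg_cosh_le (abs_half_lt hz)).trans_eq ?_
    rw [abs_div, abs_two]
  refine (neg_le_abs _).trans ?_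
  rw [abs_mul, abs_mul, abs_two]
  nlinarith [abs_nonneg s.im]

/-- The real part of the exponent is negative, so a lower bound for |cosh(z/2)| is what is needed.
The constant blows up as b → π; the limit a → π uses `norm_coshPow_le_sinh` instead. -/
lemma norm_coshPow_add_mul_I_le {s : ℂ} (hs : s.re < 1) {b u v : ℝ} (hb : b < Real.pi)
    (hv : |v| ≤ b) : ‖coshPow s (u + v * Complex.I)‖ ≤
      ((Real.cos (b / 2) / 2) ^ (2 * (s.re - 1)) * Real.exp (b * |s.im|)) *
        Real.exp (-(1 - s.re) * |u|) := by
  have hvπ : |v| < Real.pi := hv.trans_lt hb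
  have hb0 : 0 ≤ b := (abs_nonneg v).trans hv
  have hcb : 0 < Real.cos (b / 2) := cos_pos_of_abs_lt (abs_half_lt (by rwa [abs_of_nonneg hb0]))
  have h1 := norm_coshPow_le s (z := u + v * Complex.I) (by simpa using hvπ)
  have him : (u + v * Complex.I : ℂ).im = v := by simp
  have hre : (u + v * Complex.I : ℂ).re = u := by simp
  rw [him] at h1
  have h2 : Real.cos (b / 2) / 2 * Real.exp (|u| / 2) ≤
      ‖Complex.cosh ((u + v * Complex.I : ℂ) / 2)‖ := by
    rw [div_two_eq, him, hre]
    refine le_trans ?_ (cosh_mul_cos_le_norm_cosh _ _)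
    have h3 := exp_abs_le_two_mul_cosh (u / 2)
    rw [abs_div, abs_two] at h3
    have h4 : Real.cos (b / 2) ≤ Real.cos (v / 2) := by
      rw [← Real.cos_abs (v / 2), abs_div, abs_two]
      exact Real.cos_le_cos_of_nonneg_of_le_pi (by positivity) (by linarith) (by linarith)
    calc _ = Real.exp (|u| / 2) / 2 * Real.cos (b / 2) := by ring
      _ ≤ Real.cosh (u / 2) * Real.cos (v / 2) :=
        mul_le_mul (by linarith) h4 hcb.le (Real.cosh_pos _).le
  have h5 : ‖Complex.cosh ((u + v * Complex.I : ℂ) / 2)‖ ^ (2 * (s.re - 1)) ≤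
      (Real.cos (b / 2) / 2 * Real.exp (|u| / 2)) ^ (2 * (s.re - 1)) :=
    Real.rpow_le_rpow_of_nonpos (by positivity) h2 (by linarith)
  have h6 : (Real.cos (b / 2) / 2 * Real.exp (|u| / 2)) ^ (2 * (s.re - 1)) =
      (Real.cos (b / 2) / 2) ^ (2 * (s.re - 1)) * Real.exp (-(1 - s.re) * |u|) := by
    rw [Real.mul_rpow (by positivity) (by positivity), ← Real.exp_mul]
    congr 2; ring
  calc _ ≤ _ := h1
    _ ≤ ((Real.cos (b / 2) / 2) ^ (2 * (s.re - 1)) * Real.exp (-(1 - s.re) * |u|)) *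
        Real.exp (b * |s.im|) := by
      rw [← h6]
      gcongr
    _ = _ := by ring

lemma continuous_coshPow_add_mul_I (s : ℂ) {a : ℝ} (ha : |a| < Real.pi) :
    Continuous fun u : ℝ => coshPow s (u + a * Complex.I) := by
  rw [continuous_iff_continuousAt]
  intro u
  have h1 : ContinuousAt (coshPow s) (u + a * Complex.I) :=
    (differentiableAt_coshPow s (by simpa using ha)).continuousAt
  exact ContinuousAt.comp (f := fun u : ℝ => (u + a * Complex.I : ℂ)) h1 (by fun_prop)

lemma integrable_coshPow_add_mul_I {s : ℂ} (hs : s.re < 1) {a : ℝ} (ha : |a| < Real.pi) :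
    Integrable fun u : ℝ => coshPow s (u + a * Complex.I) :=
  integrable_of_norm_le_exp_neg_abs (sub_pos.2 hs) (continuous_coshPow_add_mul_I s ha)
    fun _ => norm_coshPow_add_mul_I_le hs ha le_rfl

lemma integrable_coshPow {s : ℂ} (hs : s.re < 1) : Integrable fun u : ℝ => coshPow s u := by
  simpa using integrable_coshPow_add_mul_I hs (a := 0) (by simpa using Real.pi_pos)

theorem expIntegral_coshPow_add_mul_I {s : ℂ} (hs : s.re < 1) {a : ℝ} (ha : |a| < Real.pi)
    (τ : ℝ) : expIntegral (fun u => coshPow s (u + a * Complex.I)) τ =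
      Real.exp (a * τ) * expIntegral (fun u => coshPow s u) τ :=
  expIntegral_add_mul_I (sub_pos.2 hs) (fun _ hz => differentiableAt_coshPow s (hz.trans_lt ha))
    (fun _ _ hv => norm_coshPow_add_mul_I_le hs ha hv) τ

theorem norm_expIntegral_coshPow_le {σ : ℝ} (hσ : σ < 1) {b : ℝ} (hb0 : 0 ≤ b)
    (hb : b < Real.pi) : ∃ C : ℝ, 0 ≤ C ∧ ∀ t τ : ℝ,
      ‖expIntegral (fun u => coshPow (σ + t * Complex.I) u) τ‖ ≤
        C * Real.exp (b * |t|) * Real.exp (-b * |τ|) := by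
  refine ⟨(Real.cos (b / 2) / 2) ^ (2 * (σ - 1)) * ∫ u : ℝ, Real.exp (-(1 - σ) * |u|), ?_,
    fun t τ => ?_⟩
  · have : 0 < Real.cos (b / 2) :=
      cos_pos_of_abs_lt (abs_half_lt (by rwa [abs_of_nonneg hb0]))
    exact mul_nonneg (by positivity) (integral_nonneg fun u => (Real.exp_pos _).le)
  · have hre : (σ + t * Complex.I : ℂ).re = σ := by simp
    have him : (σ + t * Complex.I : ℂ).im = t := by simp
    have := norm_expIntegral_le_exp (h := coshPow (σ + t * Complex.I)) (b := b)
      (ε := 1 - σ) (C := (Real.cos (b / 2) / 2) ^ (2 * (σ - 1)) * Real.exp (b * |t|))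
      (sub_pos.2 hσ) hb0 (fun z hz => differentiableAt_coshPow _ (hz.trans_lt hb))
      (fun u v hv => by
        have := norm_coshPow_add_mul_I_le (s := σ + t * Complex.I) (by rwa [hre]) (u := u) hb hv
        rwa [hre, him] at this) τ
    refine this.trans_eq ?_
    ring

/-! ### Decay of Γ -/

/-- Exponential decay of the Gamma function on vertical lines. -/
theorem norm_Gamma_le_exp {σ b : ℝ} (hσ : 0 < σ) (hb0 : 0 ≤ b) (hb : b < Real.pi / 2) :
    ∃ C : ℝ, 0 ≤ C ∧ ∀ t : ℝ,
      ‖Complex.Gamma (σ + t * Complex.I)‖ ≤ C * Real.exp (-b * |t|) := by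
  have hcb : 0 < Real.cos b := cos_pos_of_abs_lt (by rwa [abs_of_nonneg hb0])
  obtain ⟨C, hC0, hC⟩ : ∃ C : ℝ, 0 ≤ C ∧ ∀ u : ℝ,
      Real.exp (σ * u - Real.exp u * Real.cos b) ≤ C * Real.exp (-σ * |u|) := by
    -- For u ≥ 0, e^{σu} must become e^{-σu}; the gap e^{2σu} is at most (e^u)^n, which e^{-e^u cos
    -- b} dominates.
    obtain ⟨n, hn⟩ := exists_nat_gt (2 * σ)
    refine ⟨1 + n.factorial / Real.cos b ^ n, by positivity, fun u => ?_⟩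
    rcases le_total u 0 with h0 | h0
    · rw [abs_of_nonpos h0]
      have : Real.exp (σ * u - Real.exp u * Real.cos b) ≤ Real.exp (-σ * -u) :=
        Real.exp_le_exp.2 (by nlinarith [mul_pos (Real.exp_pos u) hcb])
      refine this.trans (le_mul_of_one_le_left (Real.exp_pos _).le ?_)
      have : 0 ≤ n.factorial / Real.cos b ^ n := by positivity
      linarith
    · rw [abs_of_nonneg h0]
      have h1 := Real.pow_div_factorial_le_exp (Real.exp u * Real.cos b) (by positivity) n
      have h2 : Real.exp (2 * σ * u) ≤ Real.exp u ^ n := by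
        rw [← Real.exp_nat_mul]
        exact Real.exp_le_exp.2 (mul_le_mul_of_nonneg_right hn.le h0)
      have h3 : Real.exp (2 * σ * u) * Real.exp (-(Real.exp u * Real.cos b)) ≤
          n.factorial / Real.cos b ^ n := by
        rw [Real.exp_neg, ← div_eq_mul_inv, div_le_div_iff₀ (Real.exp_pos _) (by positivity)]
        rw [mul_pow, div_le_iff₀ (by positivity)] at h1
        calc _ ≤ Real.exp u ^ n * Real.cos b ^ n :=
              mul_le_mul_of_nonneg_right h2 (by positivity)
          _ ≤ _ := by linarith
      have h4 : Real.exp (σ * u - Real.exp u * Real.cos b) =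
          Real.exp (2 * σ * u) * Real.exp (-(Real.exp u * Real.cos b)) *
            Real.exp (-σ * u) := by
        rw [← Real.exp_add, ← Real.exp_add]; congr 1; ring
      rw [h4]
      refine mul_le_mul_of_nonneg_right ?_ (Real.exp_pos _).le
      linarith
  refine ⟨C * ∫ u : ℝ, Real.exp (-σ * |u|),
    mul_nonneg hC0 (integral_nonneg fun u => (Real.exp_pos _).le), fun t => ?_⟩
  -- Substituting y = e^u makes Γ a Fourier integral in t; Re e^{u+iv} = e^u cos v keeps the decay
  -- for |v| ≤ b < π/2.
  have hΓ : Complex.Gamma (σ + t * Complex.I) =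
      expIntegral (fun u : ℝ => Complex.exp (σ * u - Complex.exp u)) t := by
    rw [Complex.Gamma_eq_integral (by simpa using hσ), Complex.GammaIntegral,
      ← Real.range_exp, ← image_univ, integral_image_eq_integral_abs_deriv_smul MeasurableSet.univ
        (fun x _ => (Real.hasDerivAt_exp x).hasDerivWithinAt) Real.exp_injective.injOn,
      setIntegral_univ, expIntegral]
    refine integral_congr_ae (ae_of_all _ fun u => ?_)
    have hu : (Real.exp u : ℂ) ≠ 0 := Complex.ofReal_ne_zero.2 (Real.exp_pos u).ne'
    have hpow : (Real.exp u : ℂ) ^ (σ + t * Complex.I - 1 : ℂ) =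
        Complex.exp (u * (σ + t * Complex.I - 1)) := by
      rw [Complex.cpow_def_of_ne_zero hu, ← Complex.ofReal_log (Real.exp_pos u).le, Real.log_exp]
    simp only [hpow, abs_of_pos (Real.exp_pos u), Complex.real_smul]
    rw [Complex.ofReal_exp, Complex.ofReal_exp, ← Complex.exp_add, ← Complex.exp_add,
      ← Complex.exp_add]
    congr 1
    push_cast
    ring
  rw [hΓ]
  refine norm_expIntegral_le_exp (h := fun z => Complex.exp (σ * z - Complex.exp z)) hσ hb0
    (fun z _ => by fun_prop) (fun u v hv => ?_) t
  refine le_trans ?_ (hC u)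
  rw [Complex.norm_exp]
  refine Real.exp_le_exp.2 ?_
  rw [Complex.sub_re, Complex.exp_re]
  simp only [Complex.mul_re, Complex.add_re, Complex.ofReal_re, Complex.ofReal_im, Complex.I_re,
    Complex.I_im, Complex.mul_im, Complex.add_im]
  have : Real.cos b ≤ Real.cos v := by
    rw [← Real.cos_abs v]
    exact Real.cos_le_cos_of_nonneg_of_le_pi (abs_nonneg v) (by linarith [Real.pi_pos]) hv
  have := mul_le_mul_of_nonneg_left this (Real.exp_pos u).le
  ring_nf
  ring_nf at this
  linarith

/-! ### The Mellin transform of the kernel -/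

lemma norm_cosh_I_mul_mul_le (τ u : ℝ) : ‖Complex.cosh (Complex.I * τ * u)‖ ≤ 1 := by
  have : Complex.I * τ * u = ((τ * u : ℝ) : ℂ) * Complex.I := by push_cast; ring
  rw [this, Complex.cosh_mul_I, ← Complex.ofReal_cos, Complex.norm_real]
  exact Real.abs_cos_le_one _

lemma exp_neg_le_rpow_neg {w ε : ℝ} (hw : 0 < w) (hε0 : 0 ≤ ε) (hε1 : ε ≤ 1) :
    Real.exp (-w) ≤ w ^ (-ε) := by
  rw [Real.exp_neg, Real.rpow_neg hw.le]
  refine inv_anti₀ (Real.rpow_pos_of_pos hw _) ?_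
  rcases le_total w 1 with h | h
  · exact (Real.rpow_le_one hw.le h hε0).trans (Real.one_le_exp hw.le)
  · calc w ^ ε ≤ w ^ (1 : ℝ) := Real.rpow_le_rpow_of_exponent_le h hε1
      _ = w := Real.rpow_one w
      _ ≤ _ := by linarith [Real.add_one_le_exp w]

/-- The double integrand whose iterated integrals are the Mellin transform of the kernel. -/
def klMellinIntegrand (s : ℂ) (τ : ℝ) (p : ℝ × ℝ) : ℂ :=
  (p.1 : ℂ) ^ (-s) * ((Real.exp (-p.1 / 2) : ℂ) *
    ((Real.exp (-(p.1 / 2) * Real.cosh p.2) : ℂ) * Complex.cosh (Complex.I * τ * p.2)))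

/-- Bounding e^{-w} by w^{-ε} separates the variables: decay in u is bought with y^{-ε}, harmless at
y = 0 as long as Re s + ε < 1. -/
lemma norm_klMellinIntegrand_le {s : ℂ} {ε : ℝ} (hε0 : 0 ≤ ε) (hε1 : ε ≤ 1) (τ : ℝ) {y : ℝ}
    (hy : 0 < y) (u : ℝ) : ‖klMellinIntegrand s τ (y, u)‖ ≤
      (y ^ (-s.re - ε) * Real.exp (-(1 / 2) * y ^ (1 : ℝ))) *
        ((4 : ℝ) ^ ε * Real.exp (-ε * |u|)) := by
  have h1 : Real.exp (-(y / 2) * Real.cosh u) ≤ y ^ (-ε) * ((4 : ℝ) ^ ε * Real.exp (-ε * |u|)) := by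
    have h2 : y * (Real.exp |u| / 4) ≤ y / 2 * Real.cosh u := by
      nlinarith [exp_abs_le_two_mul_cosh u]
    have h3 : 0 < y * (Real.exp |u| / 4) := by positivity
    calc Real.exp (-(y / 2) * Real.cosh u) ≤ Real.exp (-(y * (Real.exp |u| / 4))) :=
          Real.exp_le_exp.2 (by linarith)
      _ ≤ (y * (Real.exp |u| / 4)) ^ (-ε) := exp_neg_le_rpow_neg h3 hε0 hε1
      _ = _ := by
        rw [Real.mul_rpow hy.le (by positivity), Real.div_rpow (by positivity) (by positivity),
          ← Real.exp_mul, Real.rpow_neg (by norm_num : (0 : ℝ) ≤ 4), div_inv_eq_mul]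
        congr 1
        rw [mul_comm]
        congr 2
        ring
  have h5 : ‖(y : ℂ) ^ (-s)‖ = y ^ (-s.re) := by
    rw [Complex.norm_cpow_eq_rpow_re_of_pos hy, Complex.neg_re]
  have h6 : Real.exp (-y / 2) = Real.exp (-(1 / 2) * y ^ (1 : ℝ)) := by
    rw [Real.rpow_one]; congr 1; ring
  simp only [klMellinIntegrand, norm_mul, Complex.norm_real, Real.norm_of_nonneg (Real.exp_pos _).le,
    h5]
  rw [sub_eq_add_neg, Real.rpow_add hy, h6]
  have h7 := norm_cosh_I_mul_mul_le τ u
  calc _ ≤ y ^ (-s.re) * (Real.exp (-(1 / 2) * y ^ (1 : ℝ)) *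
        ((y ^ (-ε) * ((4 : ℝ) ^ ε * Real.exp (-ε * |u|))) * 1)) := by gcongr
    _ = _ := by ring

lemma integrable_klMellinIntegrand {s : ℂ} (hs0 : 0 < s.re) (hs1 : s.re < 1) (τ : ℝ) :
    Integrable (klMellinIntegrand s τ)
      ((volume.restrict (Ioi (0 : ℝ))).prod (volume.restrict (Ioi (0 : ℝ)))) := by
  have hε : 0 < (1 - s.re) / 2 := by linarith
  have h1 : IntegrableOn (fun y : ℝ => y ^ (-s.re - (1 - s.re) / 2) *
      Real.exp (-(1 / 2) * y ^ (1 : ℝ))) (Ioi 0) :=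
    integrableOn_rpow_mul_exp_neg_mul_rpow (by linarith) one_pos (by norm_num)
  have h2 : IntegrableOn (fun u : ℝ => (4 : ℝ) ^ ((1 - s.re) / 2) *
      Real.exp (-((1 - s.re) / 2) * |u|)) (Ioi 0) :=
    ((integrable_exp_neg_mul_abs hε).const_mul _).integrableOn
  refine (Integrable.mul_prod h1 h2).mono' ?_ ?_
  · unfold klMellinIntegrand
    refine Measurable.aestronglyMeasurable ?_
    fun_prop
  · rw [Measure.prod_restrict, ae_restrict_iff' (measurableSet_Ioi.prod measurableSet_Ioi)]
    refine ae_of_all _ fun p hp => ?_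
    exact norm_klMellinIntegrand_le hε.le (by linarith) τ hp.1 p.2

lemma integral_klMellinIntegrand (s : ℂ) (τ y : ℝ) :
    ∫ u in Ioi (0 : ℝ), klMellinIntegrand s τ (y, u) = klKernel τ y * (y : ℂ) ^ (-s) := by
  simp only [klMellinIntegrand, integral_const_mul, klKernel, besselK]
  ring

lemma integrableOn_klKernel_mul_cpow {s : ℂ} (hs0 : 0 < s.re) (hs1 : s.re < 1) (τ : ℝ) :
    IntegrableOn (fun y : ℝ => klKernel τ y * (y : ℂ) ^ (-s)) (Ioi 0) := by
  have := (integrable_klMellinIntegrand hs0 hs1 τ).integral_prod_left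
  simp only [integral_klMellinIntegrand] at this
  exact this

/-- Here cosh²(u/2) = (1 + cosh u)/2 is the total rate in e^{-y/2} e^{-(y/2) cosh u}; the shape is
that of the Gamma integral with this rate. -/
lemma coshPow_ofReal (s : ℂ) (u : ℝ) :
    coshPow s u = (1 / ((1 + Real.cosh u) / 2 : ℝ) : ℂ) ^ (1 - s) := by
  have hc := Real.cosh_pos (u / 2)
  have h1 : (1 + Real.cosh u) / 2 = Real.cosh (u / 2) * Real.cosh (u / 2) := by
    have h2 := Real.cosh_two_mul (u / 2)
    rw [mul_div_cancel₀ u two_ne_zero] at h2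
    nlinarith [Real.cosh_sq (u / 2)]
  have h3 : Complex.cosh ((u : ℂ) / 2) = (Real.cosh (u / 2) : ℝ) := by push_cast; rfl
  have harg : (((1 + Real.cosh u) / 2 : ℝ) : ℂ).arg ≠ Real.pi := by
    rw [Complex.arg_ofReal_of_nonneg (by rw [h1]; positivity)]
    exact Real.pi_pos.ne
  rw [coshPow, h3, one_div, Complex.inv_cpow _ _ harg, ← Complex.cpow_neg, h1, Complex.ofReal_mul,
    Complex.mul_cpow_ofReal_nonneg hc.le hc.le, neg_sub]
  have := Complex.cpow_nat_mul (Real.cosh (u / 2) : ℂ) 2 (s - 1)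
  rw [Nat.cast_two] at this
  rw [this, sq]

/-- The Mellin transform of `e^{-y/2} K_{iτ}(y/2)`. -/
theorem integral_klKernel_mul_cpow {s : ℂ} (hs0 : 0 < s.re) (hs1 : s.re < 1) (τ : ℝ) :
    ∫ y in Ioi (0 : ℝ), klKernel τ y * (y : ℂ) ^ (-s) =
      1 / 2 * Complex.Gamma (1 - s) * expIntegral (fun u => coshPow s u) τ := by
  simp only [← integral_klMellinIntegrand]
  rw [integral_integral_swap (f := fun y u => klMellinIntegrand s τ (y, u))
      (integrable_klMellinIntegrand hs0 hs1 τ),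
    expIntegral_of_even (integrable_coshPow hs1) (by
      intro u; rw [Complex.ofReal_neg, coshPow_neg])]
  have h1 : ∀ u : ℝ, ∫ y in Ioi (0 : ℝ), klMellinIntegrand s τ (y, u) =
      Complex.Gamma (1 - s) * (coshPow s u * Complex.cosh (Complex.I * τ * u)) := by
    intro u
    have hr : 0 < (1 + Real.cosh u) / 2 := by have := Real.cosh_pos u; positivity
    have h2 := Complex.integral_cpow_mul_exp_neg_mul_Ioi (a := 1 - s) (by simpa using hs1) hr
    rw [coshPow_ofReal]
    calc _ = ∫ y in Ioi (0 : ℝ), ((y : ℂ) ^ (1 - s - 1) *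
          Complex.exp (-(((1 + Real.cosh u) / 2 : ℝ) * y))) * Complex.cosh (Complex.I * τ * u) := by
          refine integral_congr_ae (ae_of_all _ fun y => ?_)
          simp only [klMellinIntegrand]
          have h3 : (Real.exp (-y / 2) : ℂ) * (Real.exp (-(y / 2) * Real.cosh u) : ℂ) =
              Complex.exp (-(((1 + Real.cosh u) / 2 : ℝ) * y)) := by
            rw [← Complex.ofReal_mul, ← Real.exp_add, Complex.ofReal_exp]
            congr 1; push_cast; ring
          rw [← h3]
          have h4 : 1 - s - 1 = -s := by ring
          rw [h4]; ring
      _ = _ := by rw [integral_mul_const, h2]; ring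
  simp only [h1]
  rw [integral_const_mul]
  ring

/-- Decay of the Mellin transform of the kernel in both variables. -/
theorem norm_integral_klKernel_mul_cpow_le {σ : ℝ} (hσ0 : 0 < σ) (hσ1 : σ < 1) {b β : ℝ}
    (hb0 : 0 ≤ b) (hb : b < Real.pi) (hβ0 : 0 ≤ β) (hβ : β < Real.pi / 2) :
    ∃ C : ℝ, 0 ≤ C ∧ ∀ t τ : ℝ,
      ‖∫ y in Ioi (0 : ℝ), klKernel τ y * (y : ℂ) ^ (-(σ + t * Complex.I))‖ ≤
        C * Real.exp ((b - β) * |t|) * Real.exp (-b * |τ|) := by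
  obtain ⟨C₁, hC₁, h₁⟩ := norm_expIntegral_coshPow_le hσ1 hb0 hb
  obtain ⟨C₂, hC₂, h₂⟩ := norm_Gamma_le_exp (sub_pos.2 hσ1) hβ0 hβ
  refine ⟨C₂ * C₁, mul_nonneg hC₂ hC₁, fun t τ => ?_⟩
  rw [integral_klKernel_mul_cpow (by simpa using hσ0) (by simpa using hσ1)]
  have h3 : (1 - (σ + t * Complex.I) : ℂ) = ((1 - σ : ℝ) : ℂ) + ((-t : ℝ) : ℂ) * Complex.I := by
    push_cast; ring
  have h4 := h₂ (-t)
  rw [abs_neg, ← h3] at h4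
  rw [norm_mul, norm_mul]
  have h5 : ‖(1 / 2 : ℂ)‖ ≤ 1 := by norm_num
  calc _ ≤ 1 * (C₂ * Real.exp (-β * |t|)) * (C₁ * Real.exp (b * |t|) * Real.exp (-b * |τ|)) := by
        gcongr
        exact h₁ t τ
    _ = C₂ * C₁ * (Real.exp (b * |t|) * Real.exp (-β * |t|)) * Real.exp (-b * |τ|) := by ring
    _ = _ := by rw [← Real.exp_add]; congr 3; ring

/-! ### Parseval on a shifted line -/

lemma continuous_expIntegral {φ : ℝ → ℂ} (hφ : Integrable φ) : Continuous (expIntegral φ) := by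
  unfold expIntegral
  refine continuous_of_dominated (bound := fun u => ‖φ u‖) (fun τ => ?_) (fun τ => ?_) hφ.norm ?_
  · exact hφ.aestronglyMeasurable.mul (by fun_prop)
  · exact ae_of_all _ fun u => by rw [norm_mul, norm_exp_I_mul_mul, mul_one]
  · exact ae_of_all _ fun u => by fun_prop

lemma expIntegral_neg_of_even {φ : ℝ → ℂ} (he : ∀ u, φ (-u) = φ u) (τ : ℝ) :
    expIntegral φ (-τ) = expIntegral φ τ := by
  unfold expIntegral
  rw [← integral_neg_eq_self]
  simp [he]

lemma besselK_I_mul_neg (τ x : ℝ) :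
    besselK (Complex.I * (-τ : ℝ)) x = besselK (Complex.I * τ) x := by
  simp [besselK]

lemma continuous_besselK_I_mul {x : ℝ} (hx : 0 < x) :
    Continuous fun τ : ℝ => besselK (Complex.I * τ) x := by
  simp only [besselK_I_mul hx]
  exact continuous_const.mul (continuous_expIntegral (integrable_exp_neg_mul_cosh hx))

/-- The Bessel factor decays at rate π/3, of which π/12 pays for |τ|, leaving π/4. -/
lemma exists_norm_mul_besselK_I_mul_le {x : ℝ} (hx : 0 < x) : ∃ C : ℝ, 0 ≤ C ∧ ∀ τ : ℝ,
    ‖(τ : ℂ) * besselK (Complex.I * τ) x‖ ≤ C * Real.exp (-(Real.pi / 4) * |τ|) := by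
  have hπ := Real.pi_pos
  obtain ⟨C, hC⟩ := norm_besselK_I_mul_le hx (b := Real.pi / 3) (by positivity) (by linarith)
  have hC0 : 0 ≤ C := by
    have := (norm_nonneg _).trans (hC 0)
    simpa using this
  refine ⟨12 / Real.pi * C, by positivity, fun τ => ?_⟩
  have h1 : |τ| ≤ 12 / Real.pi * Real.exp (Real.pi / 12 * |τ|) := by
    have := Real.add_one_le_exp (Real.pi / 12 * |τ|)
    rw [div_mul_eq_mul_div, le_div_iff₀ hπ]
    linarith
  rw [norm_mul, Complex.norm_real, Real.norm_eq_abs]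
  calc _ ≤ (12 / Real.pi * Real.exp (Real.pi / 12 * |τ|)) * (C * Real.exp (-(Real.pi / 3) * |τ|)) :=
        mul_le_mul h1 (hC τ) (norm_nonneg _) (by positivity)
    _ = 12 / Real.pi * C * (Real.exp (Real.pi / 12 * |τ|) * Real.exp (-(Real.pi / 3) * |τ|)) := by
      ring
    _ = _ := by rw [← Real.exp_add]; congr 2; ring

/-- Parseval applied to `sinhKernel x` and the shifted power. Oddness of the first and evenness of
`coshPow s` fold the line onto u > 0 and create the difference. -/
theorem integral_mul_besselK_mul_exp {s : ℂ} (hs : s.re < 1) {a x : ℝ} (ha : |a| < Real.pi)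
    (hx : 0 < x) :
    ∫ τ : ℝ, (τ : ℂ) * besselK (Complex.I * τ) x *
        (Real.exp (a * τ) * expIntegral (fun u => coshPow s u) τ) =
      Real.pi / Complex.I * ∫ u in Ioi (0 : ℝ), sinhKernel x u *
        (coshPow s (u - a * Complex.I) - coshPow s (u + a * Complex.I)) := by
  have hψ := integrable_coshPow_add_mul_I hs ha
  have hψc := continuous_coshPow_add_mul_I s ha
  have hk := integrable_sinhKernel hx
  have hψi : Integrable (expIntegral fun u => coshPow s (u + a * Complex.I)) := by
    -- The midpoint of |a| and π: still inside the strip, and beating e^{|a||τ|} by (π - |a|)/2.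
    obtain ⟨C, hC0, hC⟩ := norm_expIntegral_coshPow_le hs (b := (|a| + Real.pi) / 2)
      (by positivity) (by linarith)
    refine integrable_of_norm_le_exp_neg_abs (ε := (Real.pi - |a|) / 2)
      (C := C * Real.exp ((|a| + Real.pi) / 2 * |s.im|)) (by linarith)
      (continuous_expIntegral hψ) fun τ => ?_
    have h1 := hC s.im τ
    rw [Complex.re_add_im] at h1
    rw [expIntegral_coshPow_add_mul_I hs ha, norm_mul, Complex.norm_real,
      Real.norm_of_nonneg (Real.exp_pos _).le]
    have h2 : Real.exp (a * τ) ≤ Real.exp (|a| * |τ|) := by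
      rw [← abs_mul]; exact Real.exp_le_exp.2 (le_abs_self _)
    calc _ ≤ Real.exp (|a| * |τ|) * (C * Real.exp ((|a| + Real.pi) / 2 * |s.im|) *
          Real.exp (-((|a| + Real.pi) / 2) * |τ|)) := by gcongr
      _ = C * Real.exp ((|a| + Real.pi) / 2 * |s.im|) *
          (Real.exp (|a| * |τ|) * Real.exp (-((|a| + Real.pi) / 2) * |τ|)) := by ring
      _ = _ := by rw [← Real.exp_add]; congr 2; ring
  have hpars := integral_expIntegral_mul_expIntegral hk hψ hψc hψi
  have hsymm : ∀ u : ℝ, coshPow s ((-u : ℝ) + a * Complex.I) = coshPow s (u - a * Complex.I) := by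
    intro u
    rw [← coshPow_neg]
    congr 1; push_cast; ring
  have hprod : Integrable fun u : ℝ => sinhKernel x u * coshPow s ((-u : ℝ) + a * Complex.I) := by
    refine hk.mul_bdd (c := (Real.cos (|a| / 2) / 2) ^ (2 * (s.re - 1)) *
      Real.exp (|a| * |s.im|)) (hψc.comp continuous_neg).aestronglyMeasurable (ae_of_all _ fun u => ?_)
    refine (norm_coshPow_add_mul_I_le hs ha (le_refl |a|)).trans ?_
    refine mul_le_of_le_one_right ?_ (Real.exp_le_one_iff.2 ?_)
    · have := cos_pos_of_abs_lt (abs_half_lt (v := |a|) (by rwa [abs_abs]))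
      positivity
    · nlinarith [abs_nonneg (-u)]
  rw [integral_eq_integral_Ioi_add_neg hprod] at hpars
  simp only [hsymm, sinhKernel_neg, expIntegral_sinhKernel hx,
    expIntegral_coshPow_add_mul_I hs ha, neg_neg] at hpars
  have hfold : ∀ u : ℝ, sinhKernel x u * coshPow s (u - a * Complex.I) +
      -sinhKernel x u * coshPow s (u + a * Complex.I) = sinhKernel x u *
        (coshPow s (u - a * Complex.I) - coshPow s (u + a * Complex.I)) := fun u => by ring
  simp only [hfold] at hpars
  have h2I : (2 * Complex.I : ℂ) ≠ 0 := by simp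
  refine mul_left_cancel₀ h2I ?_
  rw [← integral_const_mul]
  calc _ = _ := by
        refine integral_congr_ae (ae_of_all _ fun τ => ?_)
        simp only []
        ring
    _ = _ := hpars
    _ = _ := by field_simp

/-! ### The substitution w = sinh²(u/2) -/

lemma image_sinh_half_sq : (fun u : ℝ => Real.sinh (u / 2) ^ 2) '' Ioi 0 = Ioi 0 := by
  ext w
  constructor
  · rintro ⟨u, hu, rfl⟩
    have hu' : 0 < u := hu
    have : 0 < Real.sinh (u / 2) := Real.sinh_pos_iff.2 (by positivity)
    exact pow_pos this 2
  · intro hw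
    have hw' : 0 < w := hw
    refine ⟨2 * Real.arsinh (√w), ?_, ?_⟩
    · have : 0 < Real.arsinh (√w) := Real.arsinh_pos_iff.2 (Real.sqrt_pos.2 hw')
      exact mul_pos two_pos this
    · simp only [mul_div_cancel_left₀ _ (two_ne_zero' ℝ), Real.sinh_arsinh, Real.sq_sqrt hw'.le]

lemma injOn_sinh_half_sq : InjOn (fun u : ℝ => Real.sinh (u / 2) ^ 2) (Ioi 0) := by
  intro u hu v hv h
  have hu' : 0 < u := hu
  have hv' : 0 < v := hv
  have h1 : 0 < Real.sinh (u / 2) := Real.sinh_pos_iff.2 (by positivity)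
  have h2 : 0 < Real.sinh (v / 2) := Real.sinh_pos_iff.2 (by positivity)
  have h3 := (sq_eq_sq₀ h1.le h2.le).1 h
  have := Real.sinh_injective h3
  linarith

lemma hasDerivAt_sinh_half_sq (u : ℝ) :
    HasDerivAt (fun u : ℝ => Real.sinh (u / 2) ^ 2) (Real.sinh u / 2) u := by
  have h1 : HasDerivAt (fun u : ℝ => Real.sinh (u / 2)) (Real.cosh (u / 2) * (1 / 2)) u :=
    ((hasDerivAt_id u).div_const 2).sinh
  have h2 := h1.pow 2
  have h3 := Real.sinh_two_mul (u / 2)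
  rw [mul_div_cancel₀ u two_ne_zero] at h3
  rw [h3]
  refine h2.congr_deriv ?_
  ring

lemma cosh_eq_one_add_two_mul_sinh_half_sq (u : ℝ) :
    Real.cosh u = 1 + 2 * Real.sinh (u / 2) ^ 2 := by
  have h2 := Real.cosh_two_mul (u / 2)
  rw [mul_div_cancel₀ u two_ne_zero] at h2
  nlinarith [Real.cosh_sq (u / 2)]

/-- Since cosh u = 1 + 2w and dw = ½ sinh u du, `sinhKernel x u` du is 2x e^{-x} e^{-2xw} dw, so
Euler's integral for Γ(s) appears. -/
lemma abs_deriv_smul_comp_sinh_half_sq (s : ℂ) (x : ℝ) {u : ℝ} (hu : 0 < u) :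
    |Real.sinh u / 2| • (((Real.sinh (u / 2) ^ 2 : ℝ) : ℂ) ^ (s - 1) *
        Complex.exp (-((2 * x : ℝ) * (Real.sinh (u / 2) ^ 2 : ℝ)))) * (2 * x * Real.exp (-x)) =
      sinhKernel x u * ((Real.sinh (u / 2) ^ 2 : ℝ) : ℂ) ^ (s - 1) := by
  have h1 : 0 < Real.sinh u := Real.sinh_pos_iff.2 hu
  rw [abs_of_pos (by positivity), sinhKernel, Complex.real_smul,
    cosh_eq_one_add_two_mul_sinh_half_sq u]
  have h2 : Real.exp (-(x * (1 + 2 * Real.sinh (u / 2) ^ 2))) =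
      Real.exp (-x) * Real.exp (-(2 * x * Real.sinh (u / 2) ^ 2)) := by
    rw [← Real.exp_add]; congr 1; ring
  rw [h2]
  push_cast
  ring

lemma integrableOn_cpow_mul_exp_neg_mul {s : ℂ} (hs : 0 < s.re) {r : ℝ} (hr : 0 < r) :
    IntegrableOn (fun w : ℝ => (w : ℂ) ^ (s - 1) * Complex.exp (-(r * w))) (Ioi 0) := by
  have h1 := integrableOn_rpow_mul_exp_neg_mul_rpow (s := s.re - 1) (by linarith) one_pos hr
  refine h1.mono' ?_ ?_
  · refine Measurable.aestronglyMeasurable ?_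
    fun_prop
  · rw [ae_restrict_iff' measurableSet_Ioi]
    refine ae_of_all _ fun w hw => ?_
    rw [norm_mul, Complex.norm_cpow_eq_rpow_re_of_pos hw, Complex.norm_exp, Real.rpow_one]
    simp

lemma integrableOn_sinhKernel_mul_cpow {s : ℂ} (hs : 0 < s.re) {x : ℝ} (hx : 0 < x) :
    IntegrableOn (fun u : ℝ => sinhKernel x u * ((Real.sinh (u / 2) ^ 2 : ℝ) : ℂ) ^ (s - 1))
      (Ioi 0) := by
  have h1 := integrableOn_cpow_mul_exp_neg_mul hs (r := 2 * x) (by positivity)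
  rw [← image_sinh_half_sq, integrableOn_image_iff_integrableOn_abs_deriv_smul measurableSet_Ioi
    (fun u _ => (hasDerivAt_sinh_half_sq u).hasDerivWithinAt) injOn_sinh_half_sq] at h1
  refine IntegrableOn.congr_fun (h1.mul_const (2 * x * Real.exp (-x) : ℂ)) (fun u hu => ?_)
    measurableSet_Ioi
  exact abs_deriv_smul_comp_sinh_half_sq s x hu

lemma integral_sinhKernel_mul_cpow {s : ℂ} (hs : 0 < s.re) {x : ℝ} (hx : 0 < x) :
    ∫ u in Ioi (0 : ℝ), sinhKernel x u * ((Real.sinh (u / 2) ^ 2 : ℝ) : ℂ) ^ (s - 1) =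
      2 * x * Real.exp (-x) * (((2 * x : ℝ) : ℂ) ^ (-s) * Complex.Gamma s) := by
  have h1 := Complex.integral_cpow_mul_exp_neg_mul_Ioi hs (r := 2 * x) (by positivity)
  rw [← image_sinh_half_sq, integral_image_eq_integral_abs_deriv_smul measurableSet_Ioi
    (fun u _ => (hasDerivAt_sinh_half_sq u).hasDerivWithinAt) injOn_sinh_half_sq] at h1
  have harg : (((2 * x : ℝ) : ℂ)).arg ≠ Real.pi := by
    rw [Complex.arg_ofReal_of_nonneg (by positivity)]
    exact Real.pi_pos.ne
  rw [one_div, Complex.inv_cpow _ _ harg, ← Complex.cpow_neg] at h1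
  rw [← h1, mul_comm, ← integral_mul_const]
  refine setIntegral_congr_fun measurableSet_Ioi fun u hu => ?_
  exact (abs_deriv_smul_comp_sinh_half_sq s x hu).symm

/-! ### Boundary values at Im z = ±π -/

lemma cosh_half_sub_pi_mul_I (u : ℝ) : Complex.cosh ((u - Real.pi * Complex.I) / 2) =
    Real.sinh (u / 2) * Complex.exp (((-(Real.pi / 2) : ℝ) : ℂ) * Complex.I) := by
  have h1 : ((u - Real.pi * Complex.I) / 2 : ℂ) =
      ((u / 2 : ℝ) : ℂ) + ((-(Real.pi / 2) : ℝ) : ℂ) * Complex.I := by push_cast; ring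
  rw [h1, cosh_add_mul_I_eq, Complex.exp_mul_I, ← Complex.ofReal_cos, ← Complex.ofReal_sin,
    Real.cos_neg, Real.sin_neg, Real.cos_pi_div_two, Real.sin_pi_div_two]
  push_cast; ring

lemma cosh_half_add_pi_mul_I (u : ℝ) : Complex.cosh ((u + Real.pi * Complex.I) / 2) =
    Real.sinh (u / 2) * Complex.exp ((Real.pi / 2 : ℝ) * Complex.I) := by
  have h1 : ((u + Real.pi * Complex.I) / 2 : ℂ) =
      ((u / 2 : ℝ) : ℂ) + ((Real.pi / 2 : ℝ) : ℂ) * Complex.I := by push_cast; ring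
  rw [h1, cosh_add_mul_I_eq, Complex.exp_mul_I, ← Complex.ofReal_cos, ← Complex.ofReal_sin,
    Real.cos_pi_div_two, Real.sin_pi_div_two]
  push_cast; ring

lemma mul_exp_mul_I_mem_slitPlane {r θ : ℝ} (hr : 0 < r) (hθ : |θ| < Real.pi) :
    (r * Complex.exp (θ * Complex.I) : ℂ) ∈ Complex.slitPlane := by
  have hθ' := abs_lt.1 hθ
  rw [Complex.mem_slitPlane_iff_arg]
  refine ⟨?_, mul_ne_zero (Complex.ofReal_ne_zero.2 hr.ne') (Complex.exp_ne_zero _)⟩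
  rw [Complex.exp_mul_I, Complex.arg_mul_cos_add_sin_mul_I hr ⟨hθ'.1, hθ'.2.le⟩]
  exact hθ'.2.ne

lemma mul_exp_mul_I_cpow {r θ : ℝ} (hr : 0 < r) (hθ : |θ| < Real.pi) (w : ℂ) :
    (r * Complex.exp (θ * Complex.I) : ℂ) ^ (2 * w) =
      ((r ^ 2 : ℝ) : ℂ) ^ w * Complex.exp (2 * θ * w * Complex.I) := by
  have hθ' := abs_lt.1 hθ
  have hr' : (r : ℂ) ≠ 0 := Complex.ofReal_ne_zero.2 hr.ne'
  have hr2 : ((r ^ 2 : ℝ) : ℂ) ≠ 0 := Complex.ofReal_ne_zero.2 (by positivity)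
  have hlog : Complex.log (r * Complex.exp (θ * Complex.I)) = (Real.log r : ℝ) + θ * Complex.I := by
    rw [Complex.log_ofReal_mul hr (Complex.exp_ne_zero _), Complex.log_exp (by simpa using hθ'.1)
      (by simpa using hθ'.2.le)]
  rw [Complex.cpow_def_of_ne_zero (mul_ne_zero hr' (Complex.exp_ne_zero _)), hlog,
    Complex.cpow_def_of_ne_zero hr2, ← Complex.ofReal_log (by positivity), Real.log_pow,
    ← Complex.exp_add]
  congr 1
  push_cast; ring

/-- On the boundary the base is ∓i sinh(u/2), so the powers carry the phases e^{∓iπ(s-1)} =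
-e^{∓iπs}, whose difference is 2i sin(πs). -/
lemma coshPow_jump (s : ℂ) {u : ℝ} (hu : 0 < u) :
    coshPow s (u - Real.pi * Complex.I) - coshPow s (u + Real.pi * Complex.I) =
      2 * Complex.I * Complex.sin (Real.pi * s) *
        ((Real.sinh (u / 2) ^ 2 : ℝ) : ℂ) ^ (s - 1) := by
  have h1 : 0 < Real.sinh (u / 2) := Real.sinh_pos_iff.2 (by positivity)
  have hp : |Real.pi / 2| < Real.pi := by
    rw [abs_of_pos (by positivity)]; linarith [Real.pi_pos]
  rw [coshPow, coshPow, cosh_half_sub_pi_mul_I, cosh_half_add_pi_mul_I,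
    mul_exp_mul_I_cpow h1 (by rwa [abs_neg]), mul_exp_mul_I_cpow h1 hp]
  have h2 : Complex.exp (2 * ((-(Real.pi / 2) : ℝ) : ℂ) * (s - 1) * Complex.I) =
      -Complex.exp (-(Real.pi * s) * Complex.I) := by
    rw [← Complex.exp_add_pi_mul_I]; congr 1; push_cast; ring
  have h3 : Complex.exp (2 * ((Real.pi / 2 : ℝ) : ℂ) * (s - 1) * Complex.I) =
      -Complex.exp ((Real.pi * s) * Complex.I) := by
    rw [← Complex.exp_sub_pi_mul_I]; congr 1; push_cast; ring
  rw [h2, h3, Complex.sin]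
  linear_combination (((Real.sinh (u / 2) ^ 2 : ℝ) : ℂ) ^ (s - 1) *
    (Complex.exp (-(Real.pi * s) * Complex.I) - Complex.exp (Real.pi * s * Complex.I))) *
      (-Complex.I_mul_I)

/-- For u > 0 the boundary bases ∓i sinh(u/2) avoid the cut of the principal power, which is
therefore continuous up to the edge. -/
lemma tendsto_coshPow_sub (s : ℂ) {u : ℝ} (hu : 0 < u) :
    Tendsto (fun a : ℝ => coshPow s (u - a * Complex.I) - coshPow s (u + a * Complex.I))
      (𝓝[<] Real.pi) (𝓝 (2 * Complex.I * Complex.sin (Real.pi * s) *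
        ((Real.sinh (u / 2) ^ 2 : ℝ) : ℂ) ^ (s - 1))) := by
  have h1 : 0 < Real.sinh (u / 2) := Real.sinh_pos_iff.2 (by positivity)
  have hp : |Real.pi / 2| < Real.pi := by
    rw [abs_of_pos (by positivity)]; linarith [Real.pi_pos]
  rw [← coshPow_jump s hu]
  refine Tendsto.mono_left ?_ nhdsWithin_le_nhds
  have hc : ∀ σ : ℂ, Complex.cosh ((u + σ * (Real.pi * Complex.I)) / 2) ∈ Complex.slitPlane →
      ContinuousAt (fun a : ℝ => coshPow s (u + σ * (a * Complex.I))) Real.pi := by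
    intro σ hσ
    unfold coshPow
    exact ContinuousAt.cpow (by fun_prop) continuousAt_const hσ
  have hm : Tendsto (fun a : ℝ => coshPow s (u - a * Complex.I)) (𝓝 Real.pi)
      (𝓝 (coshPow s (u - Real.pi * Complex.I))) := by
    have := (hc (-1) (by
      rw [neg_one_mul, ← sub_eq_add_neg, cosh_half_sub_pi_mul_I]
      exact mul_exp_mul_I_mem_slitPlane h1 (by rwa [abs_neg]))).tendsto
    simpa only [neg_one_mul, ← sub_eq_add_neg] using this
  have hpl : Tendsto (fun a : ℝ => coshPow s (u + a * Complex.I)) (𝓝 Real.pi)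
      (𝓝 (coshPow s (u + Real.pi * Complex.I))) := by
    have := (hc 1 (by
      rw [one_mul, cosh_half_add_pi_mul_I]
      exact mul_exp_mul_I_mem_slitPlane h1 hp)).tendsto
    simpa only [one_mul] using this
  exact hm.sub hpl

/-- Uniform up to the edge, because |cosh(z/2)| ≥ |sinh(u/2)|. The singularity u^{2(Re s - 1)} at 0
is integrable against `sinhKernel` when Re s > 0. -/
lemma norm_coshPow_le_sinh {s : ℂ} (hs : s.re < 1) {u v : ℝ} (hu : 0 < u) (hv : |v| < Real.pi) :
    ‖coshPow s (u + v * Complex.I)‖ ≤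
      ‖((Real.sinh (u / 2) ^ 2 : ℝ) : ℂ) ^ (s - 1)‖ * Real.exp (Real.pi * |s.im|) := by
  have h0 : 0 < Real.sinh (u / 2) := Real.sinh_pos_iff.2 (by positivity)
  have him : (u + v * Complex.I : ℂ).im = v := by simp
  have hre : (u + v * Complex.I : ℂ).re = u := by simp
  have h1 := norm_coshPow_le s (z := u + v * Complex.I) (by rwa [him])
  rw [him] at h1
  refine h1.trans ?_
  have h2 : Real.sinh (u / 2) ≤ ‖Complex.cosh ((u + v * Complex.I : ℂ) / 2)‖ := by
    rw [div_two_eq, him, hre]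
    exact (le_abs_self _).trans (abs_sinh_le_norm_cosh _ _)
  have h3 : ‖((Real.sinh (u / 2) ^ 2 : ℝ) : ℂ) ^ (s - 1)‖ =
      Real.sinh (u / 2) ^ (2 * (s.re - 1)) := by
    rw [Complex.norm_cpow_eq_rpow_re_of_pos (by positivity), Real.rpow_mul h0.le, Real.rpow_two]
    simp
  rw [h3]
  have h4 := Real.rpow_le_rpow_of_nonpos h0 h2 (by linarith : 2 * (s.re - 1) ≤ 0)
  have h5 : Real.exp (|v| * |s.im|) ≤ Real.exp (Real.pi * |s.im|) :=
    Real.exp_le_exp.2 (mul_le_mul_of_nonneg_right hv.le (abs_nonneg _))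
  gcongr

/-! ### The limit a → π and inversion on powers -/

lemma norm_mul_besselK_mul_exp_mul_le {x : ℝ} (hx : 0 < x) {σ : ℝ} (hσ : σ < 1) : ∃ C : ℝ,
    ∀ t τ a : ℝ, |a| ≤ Real.pi → ‖(τ : ℂ) * besselK (Complex.I * τ) x *
      (Real.exp (a * τ) * expIntegral (fun u => coshPow (σ + t * Complex.I) u) τ)‖ ≤
        C * Real.exp (5 * Real.pi / 6 * |t|) * Real.exp (-(Real.pi / 12) * |τ|) := by
  have hπ := Real.pi_pos
  obtain ⟨C₁, hC₁, h₁⟩ := exists_norm_mul_besselK_I_mul_le hx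
  obtain ⟨C₂, hC₂, h₂⟩ := norm_expIntegral_coshPow_le hσ (b := 5 * Real.pi / 6) (by positivity)
    (by linarith)
  -- The rates in |τ| add up to -π/4 + π - 5π/6 = -π/12, uniformly for |a| ≤ π.
  refine ⟨C₁ * C₂, fun t τ a ha => ?_⟩
  have h3 : Real.exp (a * τ) ≤ Real.exp (Real.pi * |τ|) := by
    refine Real.exp_le_exp.2 ((le_abs_self _).trans ?_)
    rw [abs_mul]
    exact mul_le_mul_of_nonneg_right ha (abs_nonneg _)
  rw [norm_mul, norm_mul (Real.exp (a * τ) : ℂ), Complex.norm_real,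
    Real.norm_of_nonneg (Real.exp_pos _).le]
  calc _ ≤ (C₁ * Real.exp (-(Real.pi / 4) * |τ|)) * (Real.exp (Real.pi * |τ|) *
        (C₂ * Real.exp (5 * Real.pi / 6 * |t|) * Real.exp (-(5 * Real.pi / 6) * |τ|))) :=
        mul_le_mul (h₁ τ) (mul_le_mul h3 (h₂ t τ) (norm_nonneg _) (Real.exp_pos _).le)
          (by positivity) (by positivity)
    _ = C₁ * C₂ * Real.exp (5 * Real.pi / 6 * |t|) * (Real.exp (-(Real.pi / 4) * |τ|) *
        Real.exp (Real.pi * |τ|) * Real.exp (-(5 * Real.pi / 6) * |τ|)) := by ring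
    _ = _ := by rw [← Real.exp_add, ← Real.exp_add]; congr 2; ring

lemma continuous_mul_besselK_mul_exp_mul {x : ℝ} (hx : 0 < x) {s : ℂ} (hs : s.re < 1) (a : ℝ) :
    Continuous fun τ : ℝ => (τ : ℂ) * besselK (Complex.I * τ) x *
      (Real.exp (a * τ) * expIntegral (fun u => coshPow s u) τ) := by
  have h1 := continuous_besselK_I_mul hx
  have h2 := continuous_expIntegral (integrable_coshPow hs)
  fun_prop

lemma integral_mul_besselK_mul_exp_pi {s : ℂ} (hs0 : 0 < s.re) (hs : s.re < 1) {x : ℝ}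
    (hx : 0 < x) :
    ∫ τ : ℝ, (τ : ℂ) * besselK (Complex.I * τ) x *
        (Real.exp (Real.pi * τ) * expIntegral (fun u => coshPow s u) τ) =
      2 * Real.pi * Complex.sin (Real.pi * s) *
        (2 * x * Real.exp (-x) * (((2 * x : ℝ) : ℂ) ^ (-s) * Complex.Gamma s)) := by
  have hπ := Real.pi_pos
  obtain ⟨C, hC⟩ := norm_mul_besselK_mul_exp_mul_le hx hs
  have hnear : ∀ᶠ a in 𝓝[<] Real.pi, |a| < Real.pi := by
    filter_upwards [Ioo_mem_nhdsLT (by linarith : -Real.pi < Real.pi)] with a ha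
    exact abs_lt.2 ha
  have hleft : Tendsto (fun a : ℝ => ∫ τ : ℝ, (τ : ℂ) * besselK (Complex.I * τ) x *
      (Real.exp (a * τ) * expIntegral (fun u => coshPow s u) τ)) (𝓝[<] Real.pi)
      (𝓝 (∫ τ : ℝ, (τ : ℂ) * besselK (Complex.I * τ) x *
        (Real.exp (Real.pi * τ) * expIntegral (fun u => coshPow s u) τ))) := by
    refine tendsto_integral_filter_of_dominated_convergence
      (fun τ => C * Real.exp (5 * Real.pi / 6 * |s.im|) * Real.exp (-(Real.pi / 12) * |τ|))
      (Eventually.of_forall fun a =>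
        (continuous_mul_besselK_mul_exp_mul hx hs a).aestronglyMeasurable) ?_
      ((integrable_exp_neg_mul_abs (by positivity)).const_mul _) (ae_of_all _ fun τ => ?_)
    · filter_upwards [hnear] with a ha
      refine ae_of_all _ fun τ => ?_
      have := hC s.im τ a ha.le
      rwa [Complex.re_add_im] at this
    · refine Tendsto.mono_left (Continuous.tendsto ?_ _) nhdsWithin_le_nhds
      fun_prop
  have hright : Tendsto (fun a : ℝ => Real.pi / Complex.I * ∫ u in Ioi (0 : ℝ), sinhKernel x u *
      (coshPow s (u - a * Complex.I) - coshPow s (u + a * Complex.I))) (𝓝[<] Real.pi)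
      (𝓝 (Real.pi / Complex.I * ∫ u in Ioi (0 : ℝ), sinhKernel x u *
        (2 * Complex.I * Complex.sin (Real.pi * s) *
          ((Real.sinh (u / 2) ^ 2 : ℝ) : ℂ) ^ (s - 1)))) := by
    refine Tendsto.const_mul _ (tendsto_integral_filter_of_dominated_convergence
      (fun u => ‖sinhKernel x u * ((Real.sinh (u / 2) ^ 2 : ℝ) : ℂ) ^ (s - 1)‖ *
        (2 * Real.exp (Real.pi * |s.im|))) ?_ ?_
      ((integrableOn_sinhKernel_mul_cpow hs0 hx).norm.mul_const _) ?_)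
    · filter_upwards [hnear] with a ha
      refine Continuous.aestronglyMeasurable ?_
      have h1 := continuous_coshPow_add_mul_I s ha
      have h2 := continuous_coshPow_add_mul_I s (a := -a) (by rwa [abs_neg])
      simp only [Complex.ofReal_neg, neg_mul, ← sub_eq_add_neg] at h2
      exact (continuous_sinhKernel x).mul (h2.sub h1)
    · filter_upwards [hnear] with a ha
      rw [ae_restrict_iff' measurableSet_Ioi]
      refine ae_of_all _ fun u hu => ?_
      have h1 := norm_coshPow_le_sinh hs hu ha
      have h2 := norm_coshPow_le_sinh hs hu (v := -a) (by rwa [abs_neg])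
      simp only [Complex.ofReal_neg, neg_mul, ← sub_eq_add_neg] at h2
      rw [norm_mul, norm_mul, mul_assoc]
      refine mul_le_mul_of_nonneg_left ?_ (norm_nonneg _)
      refine (norm_sub_le _ _).trans ?_
      linarith
    · rw [ae_restrict_iff' measurableSet_Ioi]
      exact ae_of_all _ fun u hu => (tendsto_coshPow_sub s hu).const_mul _
  have heq := tendsto_nhds_unique hleft (hright.congr' (by
    filter_upwards [hnear] with a ha
    exact (integral_mul_besselK_mul_exp hs ha hx).symm))
  rw [heq, ← integral_sinhKernel_mul_cpow hs0 hx, ← integral_const_mul, ← integral_const_mul]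
  refine integral_congr_ae (ae_of_all _ fun u => ?_)
  field_simp

/-- The Kontorovich–Lebedev inversion formula for powers. -/
theorem integral_sinh_mul_besselK_mul_mellin {s : ℂ} (hs0 : 0 < s.re) (hs : s.re < 1) {x : ℝ}
    (hx : 0 < x) :
    ∫ τ : ℝ, (τ : ℂ) * (Real.sinh (Real.pi * τ) : ℂ) * besselK (Complex.I * τ) (x / 2) *
        (∫ y in Ioi (0 : ℝ), klKernel τ y * (y : ℂ) ^ (-s)) =
      Real.pi ^ 2 * x * Real.exp (-(x / 2)) * (x : ℂ) ^ (-s) := by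
  have hx2 : 0 < x / 2 := by positivity
  set Φ : ℝ → ℝ → ℂ := fun a τ => (τ : ℂ) * besselK (Complex.I * τ) (x / 2) *
    (Real.exp (a * τ) * expIntegral (fun u => coshPow s u) τ) with hΦ
  have hint : ∀ a : ℝ, |a| ≤ Real.pi → Integrable (Φ a) := by
    intro a ha
    obtain ⟨C, hC⟩ := norm_mul_besselK_mul_exp_mul_le hx2 hs
    refine integrable_of_norm_le_exp_neg_abs (ε := Real.pi / 12)
      (C := C * Real.exp (5 * Real.pi / 6 * |s.im|)) (by positivity)
      (continuous_mul_besselK_mul_exp_mul hx2 hs a) fun τ => ?_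
    have := hC s.im τ a ha
    rwa [Complex.re_add_im] at this
  have hpos := integral_mul_besselK_mul_exp_pi hs0 hs hx2
  -- Under τ ↦ -τ only the factor τ changes sign, so both exponentials of sinh(πτ) contribute
  -- equally.
  have hneg : ∫ τ, Φ (-Real.pi) τ = -∫ τ, Φ Real.pi τ := by
    rw [← integral_neg_eq_self, ← integral_neg]
    refine integral_congr_ae (ae_of_all _ fun τ => ?_)
    simp only [hΦ, besselK_I_mul_neg, neg_mul_neg]
    rw [expIntegral_neg_of_even (fun u => by rw [Complex.ofReal_neg, coshPow_neg])]
    push_cast; ring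
  have hsplit : ∀ τ : ℝ, (τ : ℂ) * (Real.sinh (Real.pi * τ) : ℂ) *
      besselK (Complex.I * τ) (x / 2) * (∫ y in Ioi (0 : ℝ), klKernel τ y * (y : ℂ) ^ (-s)) =
      1 / 4 * Complex.Gamma (1 - s) * (Φ Real.pi τ - Φ (-Real.pi) τ) := by
    intro τ
    rw [integral_klKernel_mul_cpow hs0 hs, Real.sinh_eq]
    simp only [hΦ, neg_mul]
    push_cast; ring
  simp only [hsplit]
  rw [integral_const_mul, integral_sub (hint _ (abs_of_pos Real.pi_pos).le)
    (hint _ (by rw [abs_neg, abs_of_pos Real.pi_pos])), hneg, hpos]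
  -- The strip 0 < Re s < 1 contains no integer, so the reflection formula can be cleared of its
  -- denominator.
  have hsin : Complex.sin (Real.pi * s) ≠ 0 := by
    intro h
    obtain ⟨k, hk⟩ := Complex.sin_eq_zero_iff.1 h
    have hk' : s = k := mul_left_cancel₀ (Complex.ofReal_ne_zero.2 Real.pi_ne_zero)
      (hk.trans (mul_comm _ _))
    rw [hk', Complex.intCast_re] at hs0 hs
    have h1 : 0 < k := by exact_mod_cast hs0
    have h2 : k < 1 := by exact_mod_cast hs
    omega
  have hrefl := Complex.Gamma_mul_Gamma_one_sub s
  rw [eq_div_iff hsin] at hrefl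
  have h2x : (2 * (x / 2) : ℝ) = x := by ring
  rw [h2x]
  push_cast
  linear_combination (Real.pi * x * Complex.exp (-(x / 2)) * (x : ℂ) ^ (-s)) * hrefl

/-! ### From Lebesgue to improper Riemann integrals -/

theorem hasRiemannIntegral_of_continuous {G : ℝ → ℂ} (hG : Continuous G) (a b : ℝ) (hab : a < b) :
    HasRiemannIntegral G a b hab (∫ τ in a..b, G τ) := by
  have h1 := ContinuousOn.hasBoxIntegral (volume : Measure (Fin 1 → ℝ))
    (I := (⟨fun _ => a, fun _ => b, fun _ => hab⟩ : BoxIntegral.Box (Fin 1)))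
    (f := fun v : Fin 1 → ℝ => G (v 0)) (by fun_prop) BoxIntegral.IntegrationParams.Riemann
  have h2 : ∫ v in ((⟨fun _ => a, fun _ => b, fun _ => hab⟩ : BoxIntegral.Box (Fin 1)) :
      Set (Fin 1 → ℝ)), G (v 0) = ∫ τ in a..b, G τ := by
    rw [intervalIntegral.integral_of_le hab.le]
    have hmp := volume_preserving_funUnique (Fin 1) ℝ
    rw [← hmp.setIntegral_preimage_emb (MeasurableEquiv.measurableEmbedding _)]
    have hs : ((⟨fun _ => a, fun _ => b, fun _ => hab⟩ : BoxIntegral.Box (Fin 1)) :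
        Set (Fin 1 → ℝ)) = (MeasurableEquiv.funUnique (Fin 1) ℝ) ⁻¹' Ioc a b := by
      ext v
      simp [BoxIntegral.Box.mem_def, Fin.forall_fin_one]
    rw [hs]
    rfl
  rw [h2] at h1
  exact h1

theorem hasImproperRiemannIntegral_of_continuous {G : ℝ → ℂ} (hG : Continuous G)
    (hGi : Integrable G) : HasImproperRiemannIntegral G (∫ τ, G τ) :=
  ⟨fun a b => ∫ τ in a..b, G τ, hasRiemannIntegral_of_continuous hG,
    intervalIntegral_tendsto_integral hGi tendsto_fst tendsto_snd⟩

/-! ### Superposition of powers along the vertical line -/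

lemma integrable_norm_mul_exp_of_verticalIntegrable {c₀ ν : ℝ} (hc₀ : 0 < c₀) (hν : -1 < ν)
    {F : ℂ → ℂ} (hF : Complex.VerticalIntegrable F c₀)
    (hF' : Complex.VerticalIntegrable
      (fun s : ℂ => s ^ (ν : ℂ) * (Real.exp (Real.pi * (1 / 2) * ‖s‖) : ℂ) * F s) c₀) :
    Integrable fun t : ℝ => ‖F (c₀ + t * Complex.I)‖ * Real.exp (5 * Real.pi / 12 * |t|) := by
  have hπ := Real.pi_pos
  unfold Complex.VerticalIntegrable at hF hF'
  refine (hF'.norm.const_mul (c₀ ^ (-ν) + (1 + 12 / Real.pi))).mono'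
    (hF.aestronglyMeasurable.norm.mul (by fun_prop)) (ae_of_all _ fun t => ?_)
  set s : ℂ := c₀ + t * Complex.I with hs
  have hre : s.re = c₀ := by simp [hs]
  have him : s.im = t := by simp [hs]
  have hr : c₀ ≤ ‖s‖ := hre ▸ Complex.re_le_norm s
  have ht : |t| ≤ ‖s‖ := him ▸ Complex.abs_im_le_norm s
  have hr0 : 0 < ‖s‖ := hc₀.trans_le hr
  have hs0 : s ≠ 0 := norm_pos_iff.1 hr0
  -- For ν ≥ 0 the bound |s| ≥ c₀ suffices; for -1 < ν ≤ 0 the power is at most 1 + |s|, absorbed by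
  -- the spare rate π/12 = π/2 - 5π/12.
  have h1 : ‖s‖ ^ (-ν) ≤ (c₀ ^ (-ν) + (1 + 12 / Real.pi)) * Real.exp (Real.pi / 12 * ‖s‖) := by
    have hc : 0 < c₀ ^ (-ν) := Real.rpow_pos_of_pos hc₀ _
    have he : 1 ≤ Real.exp (Real.pi / 12 * ‖s‖) := Real.one_le_exp (by positivity)
    have hp : 0 < 12 / Real.pi := by positivity
    rcases le_total 0 ν with h | h
    · have h2 : ‖s‖ ^ (-ν) ≤ c₀ ^ (-ν) :=
        Real.rpow_le_rpow_of_nonpos hc₀ hr (by linarith)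
      nlinarith
    · have h2 : ‖s‖ ^ (-ν) ≤ 1 + ‖s‖ := by
        rcases le_total ‖s‖ 1 with h3 | h3
        · have := Real.rpow_le_one hr0.le h3 (by linarith : 0 ≤ -ν)
          linarith
        · have := Real.rpow_le_rpow_of_exponent_le h3 (by linarith : -ν ≤ 1)
          rw [Real.rpow_one] at this
          linarith
      have h4 : ‖s‖ ≤ 12 / Real.pi * Real.exp (Real.pi / 12 * ‖s‖) := by
        have := Real.add_one_le_exp (Real.pi / 12 * ‖s‖)
        rw [div_mul_eq_mul_div, le_div_iff₀ hπ]
        linarith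
      nlinarith
  have h5 : ‖s ^ (ν : ℂ)‖ = ‖s‖ ^ ν := by
    rw [Complex.norm_cpow_of_ne_zero hs0]
    simp
  have h6 : Real.exp (5 * Real.pi / 12 * |t|) ≤ (c₀ ^ (-ν) + (1 + 12 / Real.pi)) *
      (‖s‖ ^ ν * Real.exp (Real.pi * (1 / 2) * ‖s‖)) := by
    have h7 : Real.exp (5 * Real.pi / 12 * |t|) ≤ Real.exp (5 * Real.pi / 12 * ‖s‖) :=
      Real.exp_le_exp.2 (mul_le_mul_of_nonneg_left ht (by positivity))
    have h8 : ‖s‖ ^ (-ν) * ‖s‖ ^ ν = 1 := by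
      rw [← Real.rpow_add hr0, neg_add_cancel, Real.rpow_zero]
    have h9 : Real.exp (Real.pi * (1 / 2) * ‖s‖) =
        Real.exp (Real.pi / 12 * ‖s‖) * Real.exp (5 * Real.pi / 12 * ‖s‖) := by
      rw [← Real.exp_add]; congr 1; ring
    have h10 : 0 ≤ ‖s‖ ^ ν * Real.exp (5 * Real.pi / 12 * ‖s‖) := by positivity
    calc _ ≤ Real.exp (5 * Real.pi / 12 * ‖s‖) := h7
      _ = ‖s‖ ^ (-ν) * (‖s‖ ^ ν * Real.exp (5 * Real.pi / 12 * ‖s‖)) := by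
        rw [← mul_assoc, h8, one_mul]
      _ ≤ _ := mul_le_mul_of_nonneg_right h1 h10
      _ = _ := by rw [h9]; ring
  rw [norm_mul, norm_norm, Real.norm_of_nonneg (Real.exp_pos _).le, norm_mul (_ * _), norm_mul (s ^ _),
    h5, Complex.norm_real, Real.norm_of_nonneg (Real.exp_pos _).le]
  calc _ ≤ ‖F s‖ * _ := mul_le_mul_of_nonneg_left h6 (norm_nonneg _)
    _ = _ := by ring

section Transform

variable {c₀ : ℝ} {φ : ℝ → ℂ}

/-- As |y^{-it}| = 1, the integrand is a bounded multiple of a product of integrable functions of y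
and t. -/
lemma integrable_klKernel_mul_cpow_mul (hc₀ : 0 < c₀) (hc₁ : c₀ < 1) (hφ : Integrable φ) (τ : ℝ) :
    Integrable (fun p : ℝ × ℝ =>
      klKernel τ p.1 * ((p.1 : ℂ) ^ (-(c₀ + p.2 * Complex.I)) * φ p.2))
      ((volume.restrict (Ioi (0 : ℝ))).prod volume) := by
  have h1 := integrableOn_klKernel_mul_cpow (s := c₀) (by simpa using hc₀) (by simpa using hc₁) τ
  have h2 := Integrable.mul_prod h1 hφ
  have hpos : ∀ᵐ p : ℝ × ℝ ∂((volume.restrict (Ioi (0 : ℝ))).prod volume), 0 < p.1 := by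
    have : (volume.restrict (Ioi (0 : ℝ))).prod (volume : Measure ℝ) =
        (volume.prod volume).restrict (Ioi 0 ×ˢ univ) := by
      rw [← Measure.prod_restrict, Measure.restrict_univ]
    rw [this, ae_restrict_iff' (measurableSet_Ioi.prod MeasurableSet.univ)]
    exact ae_of_all _ fun p hp => hp.1
  refine (h2.mul_bdd (c := 1) (g := fun p : ℝ × ℝ => (p.1 : ℂ) ^ (-(p.2 * Complex.I))) ?_ ?_).congr ?_
  · refine Measurable.aestronglyMeasurable ?_
    fun_prop
  · filter_upwards [hpos] with p hp
    rw [Complex.norm_cpow_eq_rpow_re_of_pos hp]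
    simp
  · filter_upwards [hpos] with p hp
    rw [neg_add, Complex.cpow_add _ _ (Complex.ofReal_ne_zero.2 hp.ne')]
    ring

lemma integral_klKernel_mul_cpow_mul (τ t : ℝ) :
    ∫ y in Ioi (0 : ℝ), klKernel τ y * ((y : ℂ) ^ (-(c₀ + t * Complex.I)) * φ t) =
      (∫ y in Ioi (0 : ℝ), klKernel τ y * (y : ℂ) ^ (-(c₀ + t * Complex.I))) * φ t := by
  simp only [← mul_assoc]
  rw [integral_mul_const]

variable {f : ℝ → ℂ}

lemma klKernel_mul_eq (hf : ∀ x : ℝ, 0 < x → f x = (1 / (2 * Real.pi) : ℝ) •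
    ∫ t : ℝ, (x : ℂ) ^ (-(c₀ + t * Complex.I)) * φ t) (τ : ℝ) {y : ℝ} (hy : 0 < y) :
    klKernel τ y * f y = (1 / (2 * Real.pi) : ℝ) •
      ∫ t : ℝ, klKernel τ y * ((y : ℂ) ^ (-(c₀ + t * Complex.I)) * φ t) := by
  rw [hf y hy, integral_const_mul, mul_smul_comm]

lemma integrableOn_klKernel_mul (hc₀ : 0 < c₀) (hc₁ : c₀ < 1) (hφ : Integrable φ)
    (hf : ∀ x : ℝ, 0 < x → f x = (1 / (2 * Real.pi) : ℝ) •
      ∫ t : ℝ, (x : ℂ) ^ (-(c₀ + t * Complex.I)) * φ t) (τ : ℝ) :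
    IntegrableOn (fun y : ℝ => klKernel τ y * f y) (Ioi 0) := by
  have h1 := (integrable_klKernel_mul_cpow_mul hc₀ hc₁ hφ τ).integral_prod_left
  refine IntegrableOn.congr_fun (h1.smul (1 / (2 * Real.pi) : ℝ)) (fun y hy => ?_)
    measurableSet_Ioi
  exact (klKernel_mul_eq hf τ hy).symm

lemma klTransform_eq (hc₀ : 0 < c₀) (hc₁ : c₀ < 1) (hφ : Integrable φ)
    (hf : ∀ x : ℝ, 0 < x → f x = (1 / (2 * Real.pi) : ℝ) •
      ∫ t : ℝ, (x : ℂ) ^ (-(c₀ + t * Complex.I)) * φ t) (τ : ℝ) :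
    klTransform f τ = (1 / (2 * Real.pi) : ℝ) • ∫ t : ℝ,
      (∫ y in Ioi (0 : ℝ), klKernel τ y * (y : ℂ) ^ (-(c₀ + t * Complex.I))) * φ t := by
  rw [klTransform, setIntegral_congr_fun measurableSet_Ioi fun y hy => klKernel_mul_eq hf τ hy,
    integral_smul, integral_integral_swap
      (f := fun (y t : ℝ) => klKernel τ y * ((y : ℂ) ^ (-(c₀ + t * Complex.I)) * φ t))
      (integrable_klKernel_mul_cpow_mul hc₀ hc₁ hφ τ)]
  simp only [integral_klKernel_mul_cpow_mul]

/-- Joint measurability for Fubini, read off from the closed form of the Mellin transform. -/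
lemma measurable_integral_klKernel_mul_cpow (hc₀ : 0 < c₀) (hc₁ : c₀ < 1) :
    Measurable fun p : ℝ × ℝ =>
      ∫ y in Ioi (0 : ℝ), klKernel p.1 y * (y : ℂ) ^ (-(c₀ + p.2 * Complex.I)) := by
  have h1 : ∀ p : ℝ × ℝ,
      ∫ y in Ioi (0 : ℝ), klKernel p.1 y * (y : ℂ) ^ (-(c₀ + p.2 * Complex.I)) =
      1 / 2 * Complex.Gamma (1 - (c₀ + p.2 * Complex.I)) *
        expIntegral (fun u => coshPow (c₀ + p.2 * Complex.I) u) p.1 := fun p =>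
    integral_klKernel_mul_cpow (by simpa using hc₀) (by simpa using hc₁) p.1
  simp only [h1]
  have hΓ : Continuous fun p : ℝ × ℝ => Complex.Gamma (1 - (c₀ + p.2 * Complex.I)) := by
    rw [continuous_iff_continuousAt]
    intro p
    refine ContinuousAt.comp (g := Complex.Gamma)
      (Complex.differentiableAt_Gamma _ fun m h => ?_).continuousAt (by fun_prop)
    have := congrArg Complex.re h
    simp at this
    have hm : (0 : ℝ) ≤ m := Nat.cast_nonneg m
    linarith
  have hE : StronglyMeasurable fun p : ℝ × ℝ =>
      expIntegral (fun u => coshPow (c₀ + p.2 * Complex.I) u) p.1 := by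
    unfold expIntegral
    refine StronglyMeasurable.integral_prod_right' (f := fun q : (ℝ × ℝ) × ℝ =>
      coshPow (c₀ + q.1.2 * Complex.I) q.2 * Complex.exp (Complex.I * q.1.1 * q.2)) ?_
    refine Measurable.stronglyMeasurable ?_
    unfold coshPow
    fun_prop
  exact (hΓ.measurable.const_mul _).mul hE.measurable

/-- Continuity is what makes the final integrand Riemann integrable on bounded intervals. In the
dominating function the decay in τ is simply discarded. -/
lemma continuous_klTransform (hc₀ : 0 < c₀) (hc₁ : c₀ < 1) (hφ : Integrable φ)
    (hφ' : Integrable fun t : ℝ => ‖φ t‖ * Real.exp (5 * Real.pi / 12 * |t|))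
    (hf : ∀ x : ℝ, 0 < x → f x = (1 / (2 * Real.pi) : ℝ) •
      ∫ t : ℝ, (x : ℂ) ^ (-(c₀ + t * Complex.I)) * φ t) :
    Continuous (klTransform f) := by
  have hπ := Real.pi_pos
  obtain ⟨C, hC0, hC⟩ := norm_integral_klKernel_mul_cpow_le hc₀ hc₁ (b := 5 * Real.pi / 6)
    (β := 5 * Real.pi / 12) (by positivity) (by linarith) (by positivity) (by linarith)
  rw [funext (klTransform_eq hc₀ hc₁ hφ hf)]
  suffices h : Continuous fun τ : ℝ => ∫ t : ℝ,
      (∫ y in Ioi (0 : ℝ), klKernel τ y * (y : ℂ) ^ (-(c₀ + t * Complex.I))) * φ t from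
    h.const_smul (1 / (2 * Real.pi) : ℝ)
  refine continuous_of_dominated
    (bound := fun t => C * (‖φ t‖ * Real.exp (5 * Real.pi / 12 * |t|))) (fun τ => ?_) (fun τ => ?_)
    (hφ'.const_mul C) (ae_of_all _ fun t => ?_)
  · exact ((measurable_integral_klKernel_mul_cpow hc₀ hc₁).comp
      (measurable_const.prodMk measurable_id)).aestronglyMeasurable.mul hφ.aestronglyMeasurable
  · refine ae_of_all _ fun t => ?_
    have h1 := hC t τ
    have h2 : Real.exp (-(5 * Real.pi / 6) * |τ|) ≤ 1 :=
      Real.exp_le_one_iff.2 (by nlinarith [abs_nonneg τ])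
    have h3 : 5 * Real.pi / 6 - 5 * Real.pi / 12 = 5 * Real.pi / 12 := by ring
    rw [h3] at h1
    rw [norm_mul]
    calc _ ≤ C * Real.exp (5 * Real.pi / 12 * |t|) * 1 * ‖φ t‖ := by
          refine mul_le_mul_of_nonneg_right (h1.trans ?_) (norm_nonneg _)
          gcongr
      _ = _ := by ring
  · have h1 : ∀ τ : ℝ, ∫ y in Ioi (0 : ℝ), klKernel τ y * (y : ℂ) ^ (-(c₀ + t * Complex.I)) =
        1 / 2 * Complex.Gamma (1 - (c₀ + t * Complex.I)) *
          expIntegral (fun u => coshPow (c₀ + t * Complex.I) u) τ := fun τ =>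
      integral_klKernel_mul_cpow (by simpa using hc₀) (by simpa using hc₁) τ
    simp only [h1]
    have h2 := continuous_expIntegral
      (integrable_coshPow (s := c₀ + t * Complex.I) (by simpa using hc₁))
    fun_prop

/-- The weight of the inverse transform. -/
def klWeight (x τ : ℝ) : ℂ :=
  (τ : ℂ) * (Real.sinh (Real.pi * τ) : ℂ) * besselK (Complex.I * τ) (x / 2)

lemma continuous_klWeight {x : ℝ} (hx : 0 < x) : Continuous (klWeight x) := by
  have := continuous_besselK_I_mul (half_pos hx)
  unfold klWeight
  fun_prop

lemma exists_norm_klWeight_le {x : ℝ} (hx : 0 < x) : ∃ C : ℝ, 0 ≤ C ∧ ∀ τ : ℝ,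
    ‖klWeight x τ‖ ≤ C * Real.exp (3 * Real.pi / 4 * |τ|) := by
  obtain ⟨C, hC0, hC⟩ := exists_norm_mul_besselK_I_mul_le (half_pos hx)
  refine ⟨C, hC0, fun τ => ?_⟩
  have h1 : ‖(Real.sinh (Real.pi * τ) : ℂ)‖ ≤ Real.exp (Real.pi * |τ|) := by
    rw [Complex.norm_real, Real.norm_eq_abs, Real.abs_sinh, abs_mul, abs_of_pos Real.pi_pos,
      Real.sinh_eq]
    have h2 := Real.exp_pos (Real.pi * |τ|)
    have h3 := Real.exp_pos (-(Real.pi * |τ|))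
    linarith
  calc ‖klWeight x τ‖ = ‖(Real.sinh (Real.pi * τ) : ℂ)‖ *
        ‖(τ : ℂ) * besselK (Complex.I * τ) (x / 2)‖ := by
        rw [← norm_mul, klWeight]; congr 1; ring
    _ ≤ Real.exp (Real.pi * |τ|) * (C * Real.exp (-(Real.pi / 4) * |τ|)) := by
        gcongr
        exact hC τ
    _ = C * (Real.exp (Real.pi * |τ|) * Real.exp (-(Real.pi / 4) * |τ|)) := by ring
    _ = _ := by rw [← Real.exp_add]; congr 2; ring

/-- The rates balance: 3π/4 - 5π/6 = -π/12 in |τ|, while 5π/6 - 5π/12 = 5π/12 in |t| is exactly the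
weight available for φ. -/
lemma integrable_klWeight_mul_mellin (hc₀ : 0 < c₀) (hc₁ : c₀ < 1) (hφ : Integrable φ)
    (hφ' : Integrable fun t : ℝ => ‖φ t‖ * Real.exp (5 * Real.pi / 12 * |t|)) {x : ℝ}
    (hx : 0 < x) :
    Integrable (fun p : ℝ × ℝ => klWeight x p.1 *
      ((∫ y in Ioi (0 : ℝ), klKernel p.1 y * (y : ℂ) ^ (-(c₀ + p.2 * Complex.I))) * φ p.2))
      (volume.prod volume) := by
  have hπ := Real.pi_pos
  obtain ⟨C₁, hC₁, h₁⟩ := exists_norm_klWeight_le hx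
  obtain ⟨C₂, hC₂, h₂⟩ := norm_integral_klKernel_mul_cpow_le hc₀ hc₁ (b := 5 * Real.pi / 6)
    (β := 5 * Real.pi / 12) (by positivity) (by linarith) (by positivity) (by linarith)
  refine ((Integrable.mul_prod (integrable_exp_neg_mul_abs (ε := Real.pi / 12) (by positivity))
    hφ').const_mul (C₁ * C₂)).mono' ?_ (ae_of_all _ fun p => ?_)
  · refine AEStronglyMeasurable.mul ?_ (AEStronglyMeasurable.mul ?_ ?_)
    · exact ((continuous_klWeight hx).comp continuous_fst).aestronglyMeasurable
    · exact (measurable_integral_klKernel_mul_cpow hc₀ hc₁).aestronglyMeasurable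
    · exact hφ.aestronglyMeasurable.comp_snd
  · rw [norm_mul, norm_mul]
    have h3 : 5 * Real.pi / 6 - 5 * Real.pi / 12 = 5 * Real.pi / 12 := by ring
    have h4 := h₂ p.2 p.1
    rw [h3] at h4
    calc _ ≤ (C₁ * Real.exp (3 * Real.pi / 4 * |p.1|)) *
          ((C₂ * Real.exp (5 * Real.pi / 12 * |p.2|) * Real.exp (-(5 * Real.pi / 6) * |p.1|)) *
            ‖φ p.2‖) :=
          mul_le_mul (h₁ p.1) (mul_le_mul_of_nonneg_right h4 (norm_nonneg _)) (by positivity)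
            (by positivity)
      _ = C₁ * C₂ * ((Real.exp (3 * Real.pi / 4 * |p.1|) *
          Real.exp (-(5 * Real.pi / 6) * |p.1|)) *
            (‖φ p.2‖ * Real.exp (5 * Real.pi / 12 * |p.2|))) := by ring
      _ = _ := by rw [← Real.exp_add]; congr 3; ring_nf

lemma klWeight_mul_klTransform (hc₀ : 0 < c₀) (hc₁ : c₀ < 1) (hφ : Integrable φ)
    (hf : ∀ x : ℝ, 0 < x → f x = (1 / (2 * Real.pi) : ℝ) •
      ∫ t : ℝ, (x : ℂ) ^ (-(c₀ + t * Complex.I)) * φ t) (x τ : ℝ) :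
    klWeight x τ * klTransform f τ = (1 / (2 * Real.pi) : ℝ) • ∫ t : ℝ, klWeight x τ *
      ((∫ y in Ioi (0 : ℝ), klKernel τ y * (y : ℂ) ^ (-(c₀ + t * Complex.I))) * φ t) := by
  rw [klTransform_eq hc₀ hc₁ hφ hf, integral_const_mul, mul_smul_comm]

theorem integrable_klWeight_mul_klTransform (hc₀ : 0 < c₀) (hc₁ : c₀ < 1) (hφ : Integrable φ)
    (hφ' : Integrable fun t : ℝ => ‖φ t‖ * Real.exp (5 * Real.pi / 12 * |t|))
    (hf : ∀ x : ℝ, 0 < x → f x = (1 / (2 * Real.pi) : ℝ) •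
      ∫ t : ℝ, (x : ℂ) ^ (-(c₀ + t * Complex.I)) * φ t) {x : ℝ} (hx : 0 < x) :
    Integrable fun τ : ℝ => klWeight x τ * klTransform f τ := by
  simp only [klWeight_mul_klTransform hc₀ hc₁ hφ hf]
  exact Integrable.smul (1 / (2 * Real.pi) : ℝ)
    (integrable_klWeight_mul_mellin hc₀ hc₁ hφ hφ' hx).integral_prod_left

/-- After Fubini the inner τ-integral is the power case, and what remains is the Mellin
representation of f. -/
theorem integral_klWeight_mul_klTransform (hc₀ : 0 < c₀) (hc₁ : c₀ < 1) (hφ : Integrable φ)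
    (hφ' : Integrable fun t : ℝ => ‖φ t‖ * Real.exp (5 * Real.pi / 12 * |t|))
    (hf : ∀ x : ℝ, 0 < x → f x = (1 / (2 * Real.pi) : ℝ) •
      ∫ t : ℝ, (x : ℂ) ^ (-(c₀ + t * Complex.I)) * φ t) {x : ℝ} (hx : 0 < x) :
    ∫ τ : ℝ, klWeight x τ * klTransform f τ =
      Real.pi ^ 2 * x * Real.exp (-(x / 2)) * f x := by
  simp only [klWeight_mul_klTransform hc₀ hc₁ hφ hf]
  rw [integral_smul, integral_integral_swap (f := fun (τ t : ℝ) => klWeight x τ *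
    ((∫ y in Ioi (0 : ℝ), klKernel τ y * (y : ℂ) ^ (-(c₀ + t * Complex.I))) * φ t))
    (integrable_klWeight_mul_mellin hc₀ hc₁ hφ hφ' hx), hf x hx, mul_smul_comm,
    ← integral_const_mul]
  congr 1
  refine integral_congr_ae (ae_of_all _ fun t => ?_)
  have h1 := integral_sinh_mul_besselK_mul_mellin (s := c₀ + t * Complex.I)
    (by simpa using hc₀) (by simpa using hc₁) hx
  simp only [← mul_assoc (klWeight x _)]
  rw [integral_mul_const]
  simp only [klWeight]
  rw [h1]
  ring

end Transform

end

theorem theorem9 (c₀ ν : ℝ) (hc₀ : 0 < c₀) (hc₁ : c₀ < 1) (hν : c₀ - 1 < ν)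
    (f : ℝ → ℂ) (hf : MemInvMellin (1 / 2) ν c₀ f) :
    (∀ τ : ℝ, IntegrableOn (fun y : ℝ => klKernel τ y * f y) (Ioi 0)) ∧
    ∀ x : ℝ, 0 < x → ∃ J : ℂ,
      HasImproperRiemannIntegral
        (fun τ : ℝ => (τ : ℂ) * (Real.sinh (Real.pi * τ) : ℂ) *
          besselK (Complex.I * τ) (x / 2) * klTransform f τ) J ∧
      f x = (Real.exp (x / 2) : ℂ) / ((Real.pi : ℂ) ^ 2 * (x : ℂ)) * J := by
  obtain ⟨F, hF, hF', hfF⟩ := hf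
  have hφ' := integrable_norm_mul_exp_of_verticalIntegrable hc₀ (by linarith) hF hF'
  have hφ : Integrable fun t : ℝ => F (c₀ + t * Complex.I) := hF
  have hf : ∀ x : ℝ, 0 < x → f x = (1 / (2 * Real.pi) : ℝ) •
      ∫ t : ℝ, (x : ℂ) ^ (-(c₀ + t * Complex.I)) * F (c₀ + t * Complex.I) := hfF
  refine ⟨integrableOn_klKernel_mul hc₀ hc₁ hφ hf, fun x hx => ⟨_,
    hasImproperRiemannIntegral_of_continuous
      ((continuous_klWeight hx).mul (continuous_klTransform hc₀ hc₁ hφ hφ' hf))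
      (integrable_klWeight_mul_klTransform hc₀ hc₁ hφ hφ' hf hx), ?_⟩⟩
  have hJ := integral_klWeight_mul_klTransform hc₀ hc₁ hφ hφ' hf hx
  simp only [klWeight] at hJ
  rw [hJ, Real.exp_neg]
  have h1 : (Real.exp (x / 2) : ℂ) ≠ 0 := Complex.ofReal_ne_zero.2 (Real.exp_pos _).ne'
  have h2 : (Real.pi : ℂ) ≠ 0 := Complex.ofReal_ne_zero.2 Real.pi_ne_zero
  have h3 : (x : ℂ) ≠ 0 := Complex.ofReal_ne_zero.2 hx.ne'
  rw [Complex.ofReal_inv]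
  field_simp
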